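/- Write points of $\mathbf R^{n+1}$ as $(X,t)$ with $X\in\mathbf R^n$, $t\in\mathbf R$, and let $\hat f(\xi,\tau)=\int f(X,t)e^{-2\pi i(X\cdot\xi+t\tau)}\,dX\,dt$, extended to complex-valued tempered distributions $\mathcal S'(\mathbf R^{n+1})$. Let $\phi\in\mathcal S(\mathbf R^{n+1})$ satisfy $\hat\phi>0$ on $\{\frac12<|\xi|+|\tau|^{1/2}<2\}$, $\hat\phi=0$ elsewhere, and $\sum_{i\in\mathbf Z}\hat\phi(2^{-i}\xi,2^{-2i}\tau)=1$ for $(\xi,\tau)\ne(0,0)$. Put $\hat\phi_i(\xi,\tau)=\hat\phi(2^{-i}\xi,2^{-2i}\tau)$ and $\hat\psi=1-\sum_{i\ge1}\hat\phi_i$. For $\alpha\in\mathbf R$ and $1\le p\le\infty$ let $\mathcal B^{\alpha,\alpha/2}_p(\mathbf R^{n+1})$ be the set of all $f\in\mathcal S'(\mathbf R^{n+1})$ for which $$\|f\|_{\mathcal B^{\alpha,\alpha/2}_p}=\|\psi*f\|_{L^p}+\Big(\sum_{i\ge1}\big(2^{\alpha i}\|\phi_i*f\|_{L^p}\big)^p\Big)^{1/p}\quad(p<\infty),\qquad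 \|f\|_{\mathcal B^{\alpha,\alpha/2}_\infty}=\sup\big\{\|\psi*f\|_{L^\infty},\ 2^{\alpha i}\|\phi_i*f\|_{L^\infty}: i\ge1\big\}$$ is finite (the $L^p$ norm of a distribution that is not an $L^p$ function being $\infty$). Let $D_{X_k}f$, $1\le k\le n$, be the distributional derivatives, and let $D_t^{1/2}f\in\mathcal S'$ be the distribution with Fourier transform $|\tau|^{1/2}\hat f$, where $|\tau|^{1/2}\hat f:=\lim_{\varepsilon\to0^+}(\varepsilon^2+\tau^2)^{1/4}\hat f$ in $\mathcal S'$ (pointwise on Schwartz functions) whenever this limit exists. **Theorem.** Let $1\le p\le\infty$ and $\alpha\in\mathbf R$. (0) $D_t^{1/2}f$ exists (and is unique) for every $f\in\mathcal B^{\alpha-1,\frac{\alpha}{2}-\frac12}_p(\mathbf R^{n+1})$. (1) A distribution $f\in\mathcal S'(\mathbf R^{n+1})$ lies in $\mathcal B^{\alpha,\alpha/2}_p(\mathbf R^{n+1})$ if and only if $f$, $D_{X_k}f$ for all $1\le k\le n$, and $D_t^{1/2}f$ (which is part of the condition to exist) all lie in $\mathcal B^{\alpha-1,\frac\alpha2-\frac12}_p(\mathbf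 R^{n+1})$. (2) There is a constant $C$, depending only on $n,p,\alpha,\phi$, such that for every $f\in\mathcal S'(\mathbf R^{n+1})$ for which $D_t^{1/2}f$ exists (norms may be $\infty$) $$\|f\|_{\mathcal B^{\alpha,\alpha/2}_p}\le C\,N(f)\quad\text{and}\quad N(f)\le C\,\|f\|_{\mathcal B^{\alpha,\alpha/2}_p},$$ $$N(f)=\|f\|_{\mathcal B^{\alpha-1,\frac\alpha2-\frac12}_p}+\sum_{k=1}^n\|D_{X_k}f\|_{\mathcal B^{\alpha-1,\frac\alpha2-\frac12}_p}+\|D_t^{1/2}f\|_{\mathcal B^{\alpha-1,\frac\alpha2-\frac12}_p}.$$ -/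

import Mathlib

open MeasureTheory Filter
open scoped SchwartzMap FourierTransform LineDeriv ENNReal NNReal Topology

noncomputable section

namespace ParabolicBesov

/-- Space-time `ℝⁿ⁺¹`. The first `n` coordinates of a point are the space variable `X` (or its
frequency `ξ`), the last one is the time `t` (or its frequency `τ`). -/
abbrev SpaceTime (n : ℕ) : Type := EuclideanSpace ℝ (Fin (n + 1))

/-- The space part `ξ` of a point `(ξ, τ)`. -/
def spacePart {n : ℕ} (z : SpaceTime n) : EuclideanSpace ℝ (Fin n) :=
  WithLp.toLp 2 fun k => z k.castSucc

/-- The time part `τ` of a point `(ξ, τ)`. -/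
def timePart {n : ℕ} (z : SpaceTime n) : ℝ := z (Fin.last n)

/-- The parabolic gauge `|ξ| + |τ|^{1/2}`. -/
def gauge {n : ℕ} (z : SpaceTime n) : ℝ := ‖spacePart z‖ + √|timePart z|

/-- The parabolic dilation `(ξ, τ) ↦ (r ξ, r² τ)`. -/
def dilate {n : ℕ} (r : ℝ) (z : SpaceTime n) : SpaceTime n :=
  WithLp.toLp 2 (Fin.snoc (fun k : Fin n => r * z k.castSucc) (r ^ 2 * z (Fin.last n)))

/-- The symbol `(ξ, τ) ↦ φ̂(2⁻ⁱ ξ, 2⁻²ⁱ τ)`, the Fourier transform of `φ_i`. -/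
def phiHat {n : ℕ} (φ : 𝓢(SpaceTime n, ℂ)) (i : ℤ) (z : SpaceTime n) : ℂ :=
  𝓕 φ (dilate ((2 : ℝ) ^ (-i)) z)

/-- The symbol `1 - ∑_{i ≥ 1} φ̂(2⁻ⁱ ξ, 2⁻²ⁱ τ)`, the Fourier transform of `ψ`. -/
def psiHat {n : ℕ} (φ : 𝓢(SpaceTime n, ℂ)) (z : SpaceTime n) : ℂ :=
  1 - ∑' i : ℕ, phiHat φ ((i : ℤ) + 1) z

/-- `φ` generates a parabolic dyadic resolution of unity: `φ̂` is (real and) positive on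
`1/2 < |ξ| + |τ|^{1/2} < 2`, zero elsewhere, and its parabolic dyadic dilates sum to `1` off
the origin. -/
structure IsGenerator {n : ℕ} (φ : 𝓢(SpaceTime n, ℂ)) : Prop where
  pos : ∀ z : SpaceTime n, 1 / 2 < gauge z → gauge z < 2 → ∃ r : ℝ, 0 < r ∧ 𝓕 φ z = (r : ℂ)
  zero : ∀ z : SpaceTime n, ¬(1 / 2 < gauge z ∧ gauge z < 2) → 𝓕 φ z = 0
  sum_eq_one : ∀ z : SpaceTime n, z ≠ 0 → HasSum (fun i : ℤ => phiHat φ i z) 1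

/-- The convolution `k * f` of a tempered distribution `f` with the function `k` whose Fourier
transform is `m`, that is, the distribution with Fourier transform `m f̂`
(`m` smooth, with all derivatives of polynomial growth). -/
def convHat {n : ℕ} (m : SpaceTime n → ℂ) (f : 𝓢'(SpaceTime n, ℂ)) : 𝓢'(SpaceTime n, ℂ) :=
  TemperedDistribution.fourierMultiplierCLM ℂ m f

/-- The `L^p` norm of a tempered distribution: the `L^p` norm of the function that represents it,
and `∞` if the distribution is not (represented by) a function in `L^p`. -/
def lpENorm {n : ℕ} (p : ℝ≥0∞) [Fact (1 ≤ p)] (f : 𝓢'(SpaceTime n, ℂ)) : ℝ≥0∞ :=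
  ⨅ (g : Lp ℂ p (volume : Measure (SpaceTime n))) (_ : (g : 𝓢'(SpaceTime n, ℂ)) = f), ‖g‖ₑ

open scoped Classical in
/-- The norm of the parabolic Besov space `B^{α,α/2}_{pq}(ℝⁿ⁺¹)` (possibly `∞`), built from the
generator `φ`. -/
def besovENorm {n : ℕ} (φ : 𝓢(SpaceTime n, ℂ)) (α : ℝ) (p q : ℝ≥0∞) [Fact (1 ≤ p)]
    (f : 𝓢'(SpaceTime n, ℂ)) : ℝ≥0∞ :=
  if q = ∞ then
    max (lpENorm p (convHat (psiHat φ) f))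
      (⨆ i : ℕ, (2 : ℝ≥0∞) ^ (α * ((i : ℝ) + 1)) *
        lpENorm p (convHat (phiHat φ ((i : ℤ) + 1)) f))
  else
    lpENorm p (convHat (psiHat φ) f) +
      (∑' i : ℕ, ((2 : ℝ≥0∞) ^ (α * ((i : ℝ) + 1)) *
        lpENorm p (convHat (phiHat φ ((i : ℤ) + 1)) f)) ^ q.toReal) ^ (1 / q.toReal)

/-- The parabolic Besov space `B^{α,α/2}_{pq}(ℝⁿ⁺¹)`. -/
def besovSpace {n : ℕ} (φ : 𝓢(SpaceTime n, ℂ)) (α : ℝ) (p q : ℝ≥0∞) [Fact (1 ≤ p)] :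
    Set 𝓢'(SpaceTime n, ℂ) :=
  {f | besovENorm φ α p q f < ∞}

/-- The distributional derivative `D_{X_k} f`. -/
def spaceDeriv {n : ℕ} (k : Fin n) (f : 𝓢'(SpaceTime n, ℂ)) : 𝓢'(SpaceTime n, ℂ) :=
  ∂_{(EuclideanSpace.single k.castSucc 1 : SpaceTime n)} f

/-- `w` is the product `|τ|^{1/2} v` of the tempered distribution `v` with the function
`|τ|^{1/2}`. That function is not smooth, so the product is the limit in `𝓢'` of the products
with the smooth functions `(ε² + τ²)^{1/4}` as `ε → 0⁺`. It is unique when it exists, and it is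
the pointwise product when `v` is a locally integrable function of polynomial growth. -/
def IsSqrtTimeMul {n : ℕ} (v w : 𝓢'(SpaceTime n, ℂ)) : Prop :=
  Tendsto
    (fun ε : ℝ => TemperedDistribution.smulLeftCLM ℂ
      (fun z : SpaceTime n => (((ε ^ 2 + timePart z ^ 2) ^ (1 / 4 : ℝ) : ℝ) : ℂ)) v)
    (𝓝[>] 0) (𝓝 w)

/-- `u = D_t^{1/2} f`, that is, `û = |τ|^{1/2} f̂`. -/
def IsHalfTimeDeriv {n : ℕ} (f u : 𝓢'(SpaceTime n, ℂ)) : Prop :=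
  IsSqrtTimeMul (𝓕 f) (𝓕 u)

end ParabolicBesov

end

/-! The argument works one dyadic piece at a time. On the piece of frequency scale `2^i` the symbols
`ξ_k` and `|τ|^{1/2}` have size at most about `2^i`, so one derivative costs at most that factor
(`exists_bernstein`). They do not all become small there simultaneously, so the piece is recovered
from its derivatives with the gain `2^{-i}` (`IsGenerator.exists_reverse_bernstein`). Weighted `ℓ^p`
norms of these two bounds give the equivalence.

The obstacle is that `|τ|^{1/2}` is not smooth on `τ = 0`, so a localized half derivative is not
automatically convolution with a Schwartz kernel. The substitute is `isLpMultiplier_halfSymbol_sub`.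
The derivative of `l ↦ (l + τ²)^{1/4}` is a positive superposition of Gaussians `e^{-sτ²}`, so for
`δ ≤ ε` the difference `(ε² + τ²)^{1/4} - (δ² + τ²)^{1/4}` is the Fourier transform of a positive
measure whose mass is the value at `τ = 0`, namely `√ε - √δ`. Hence it acts on every `L^p`, `1 ≤ p ≤
∞`, with at most that norm. Regularized half derivatives are therefore Cauchy as `ε → 0⁺`, and on a
frequency-localized function they are bounded uniformly in `ε`.

For the reverse inequality one never divides by `|τ|^{1/2}`. The polynomial `P = |ξ|⁴ + τ²` vanishes
only at the origin, so on an annulus `1 = P W` with `W` Schwartz, and `P` splits as `∑ (|ξ|² ξ_k)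
ξ_k + ((ε² + τ²)^{1/4})⁴ - ε²`. One factor of each main term is the derivative, the others are
bounded multipliers, and the last term disappears in the limit.

For existence, dividing the pieces by a high power `P^N` makes their sum converge in `L^p`. So `f =
g₀ + P^N(D) g₁` with `g₀, g₁` in `L^p` (`IsGenerator.exists_eq_add_convHat_parabolicPoly`); half
derivatives of `L^p` functions exist and commute with polynomial multipliers. -/

noncomputable section

namespace ParabolicBesov

/-! ### Multipliers that are Fourier transforms of finite measures. -/

section Kernel

variable {E : Type*} [NormedAddCommGroup E] [InnerProductSpace ℝ E] [FiniteDimensional ℝ E]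
  [MeasurableSpace E] [BorelSpace E]
  {Ω : Type*} [MeasurableSpace Ω]

/-- Minkowski's inequality for averages of translates of a function. -/
theorem eLpNorm_lintegral_translate_le {p : ℝ≥0∞} (hp : 1 ≤ p) {ν : Measure Ω} [SFinite ν]
    {Y : Ω → E} (hY : Measurable Y) {G : E → ℝ≥0∞} (hG : Measurable G) (hν : ν Set.univ ≠ ∞) :
    eLpNorm (fun x => ∫⁻ ω, G (x - Y ω) ∂ν) p volume ≤ ν Set.univ * eLpNorm G p volume := by
  have hF : Measurable (fun q : E × Ω => G (q.1 - Y q.2)) :=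
    hG.comp (measurable_fst.sub (hY.comp measurable_snd))
  rcases eq_or_ne p ∞ with rfl | hpt
  · rw [eLpNorm_exponent_top, eLpNorm_exponent_top]
    have h1 : ∀ᵐ x ∂(volume : Measure E), ∀ᵐ ω ∂ν, G (x - Y ω) ≤ eLpNormEssSup G volume := by
      refine (Measure.ae_ae_comm (p := fun x ω => G (x - Y ω) ≤ eLpNormEssSup G volume)
        (measurableSet_le hF measurable_const)).2 (Eventually.of_forall ?_)
      intro ω
      have h2 : ∀ᵐ x ∂(volume : Measure E), G x ≤ eLpNormEssSup G volume := by
        simpa using ae_le_eLpNormEssSup (f := G) (μ := (volume : Measure E))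
      exact (measurePreserving_sub_right volume (Y ω)).quasiMeasurePreserving.ae h2
    refine eLpNormEssSup_le_of_ae_enorm_bound ?_
    filter_upwards [h1] with x hx
    calc ‖∫⁻ ω, G (x - Y ω) ∂ν‖ₑ = ∫⁻ ω, G (x - Y ω) ∂ν := by simp
      _ ≤ ∫⁻ _, eLpNormEssSup G volume ∂ν := lintegral_mono_ae hx
      _ = ν Set.univ * eLpNormEssSup G volume := by rw [lintegral_const, mul_comm]
  · have hp0 : p ≠ 0 := (zero_lt_one.trans_le hp).ne'
    have hq : 1 ≤ p.toReal := by simpa using (ENNReal.toReal_le_toReal (by simp) hpt).2 hp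
    set q := p.toReal
    have hq0 : 0 < q := by linarith
    rw [eLpNorm_eq_lintegral_rpow_enorm_toReal hp0 hpt, eLpNorm_eq_lintegral_rpow_enorm_toReal hp0 hpt]
    simp only [enorm_eq_self]
    -- Jensen for the finite measure `ν`. After it, Tonelli and translation invariance in `x` finish
    -- the case `p < ∞`.
    have key : ∀ x : E, (∫⁻ ω, G (x - Y ω) ∂ν) ^ q ≤
        (∫⁻ ω, G (x - Y ω) ^ q ∂ν) * ν Set.univ ^ (q - 1) := by
      intro x
      have hm : Measurable (fun ω => G (x - Y ω)) := hG.comp (measurable_const.sub hY)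
      have := eLpNorm'_le_eLpNorm'_mul_rpow_measure_univ (μ := ν) zero_lt_one hq
        hm.aestronglyMeasurable
      simp only [eLpNorm', enorm_eq_self, ENNReal.rpow_one, div_one] at this
      calc _ ≤ ((∫⁻ ω, G (x - Y ω) ^ q ∂ν) ^ (1 / q) * ν Set.univ ^ (1 - 1 / q)) ^ q := by gcongr
        _ = _ := by
          rw [ENNReal.mul_rpow_of_nonneg _ _ hq0.le, ← ENNReal.rpow_mul, ← ENNReal.rpow_mul]
          congr 2
          · field_simp; simp
          · field_simp
    calc (∫⁻ x, (∫⁻ ω, G (x - Y ω) ∂ν) ^ q) ^ (1 / q)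
        ≤ (∫⁻ x, (∫⁻ ω, G (x - Y ω) ^ q ∂ν) * ν Set.univ ^ (q - 1)) ^ (1 / q) := by
          gcongr with x; exact key x
      _ = ((∫⁻ ω, (∫⁻ x, G (x - Y ω) ^ q) ∂ν) * ν Set.univ ^ (q - 1)) ^ (1 / q) := by
          rw [lintegral_mul_const _ (by exact (hF.pow_const q).lintegral_prod_right'),
            lintegral_lintegral_swap (hF.pow_const q).aemeasurable]
      _ = (ν Set.univ ^ q * ∫⁻ x, G x ^ q) ^ (1 / q) := by
          have h3 : ∀ ω, ∫⁻ x, G (x - Y ω) ^ q = ∫⁻ x, G x ^ q := fun ω =>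
            lintegral_sub_right_eq_self (fun x => G x ^ q) (Y ω)
          simp_rw [h3, lintegral_const]
          congr 1
          rw [mul_assoc, mul_comm]
          congr 1
          -- Adding the exponents `1` and `q - 1` needs a base different from `0` and `∞`.
          rcases eq_or_ne (ν Set.univ) 0 with h0 | h0
          · simp [h0, hq0]
          · conv_lhs => enter [1]; rw [← ENNReal.rpow_one (ν Set.univ)]
            rw [← ENNReal.rpow_add _ _ h0 hν]; congr 1; ring
      _ = _ := by
          rw [ENNReal.mul_rpow_of_nonneg _ _ (by positivity), ← ENNReal.rpow_mul]
          congr 1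
          field_simp; simp

/-- Hölder, uniform in the translation. In `ℝ≥0∞` the exponent `(1 - p⁻¹)⁻¹` is the conjugate of `p`
at both ends too: `∞` for `p = 1` and `1` for `p = ∞`. -/
theorem lintegral_mul_translate_le {p : ℝ≥0∞} (hp : 1 ≤ p) {f g : E → ℂ}
    (hf : AEStronglyMeasurable f volume) (hg : AEStronglyMeasurable g volume) (y : E) :
    ∫⁻ x, ‖f (x + y)‖ₑ * ‖g x‖ₑ ≤ eLpNorm f (1 - p⁻¹)⁻¹ volume * eLpNorm g p volume := by
  have := ENNReal.HolderConjugate.inv_one_sub_inv' hp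
  have : ((1 - p⁻¹)⁻¹).HolderTriple p 1 := ENNReal.HolderTriple.symm (p := p)
  have hmp := measurePreserving_add_right (volume : Measure E) y
  have h := eLpNorm_smul_le_mul_eLpNorm (p := (1 - p⁻¹)⁻¹) (q := p) (r := 1) hg
    (hf.comp_measurePreserving hmp)
  rw [eLpNorm_comp_measurePreserving hf hmp, eLpNorm_one_eq_lintegral_enorm] at h
  simpa [enorm_smul] using h

/-- The transpose of the multiplier, acting on test functions. It translates by `+Y`, whereas the
operator on `L^p` translates by `-Y`. -/
theorem fourier_smulLeft_fourierInv_eq_integral {μ : Measure Ω} [SFinite μ] {κ : Ω → ℂ}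
    (hκ : Integrable κ μ) {Y : Ω → E} (hY : Measurable Y) {m : E → ℂ} (hm : m.HasTemperateGrowth)
    (hmk : ∀ ξ, m ξ = ∫ ω, Complex.exp (↑(-2 * Real.pi * inner ℝ ξ (Y ω)) * Complex.I) * κ ω ∂μ)
    (η : 𝓢(E, ℂ)) (x : E) :
    𝓕 (SchwartzMap.smulLeftCLM ℂ m (𝓕⁻ η)) x = ∫ ω, κ ω * η (x + Y ω) ∂μ := by
  have h1 : ∀ z : E, η z = ∫ ξ, Complex.exp (↑(-2 * Real.pi * inner ℝ ξ z) * Complex.I) *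
      𝓕⁻ η ξ := by
    intro z
    have : 𝓕 (𝓕⁻ η) z = η z := by rw [FourierTransform.fourier_fourierInv_eq]
    rw [← this, SchwartzMap.fourier_coe, Real.fourier_eq']
    simp [smul_eq_mul]
  simp_rw [h1 (x + Y _)]
  rw [SchwartzMap.fourier_coe, Real.fourier_eq']
  simp only [SchwartzMap.smulLeftCLM_apply_apply hm, smul_eq_mul, hmk, ← integral_const_mul,
    ← integral_mul_const]
  rw [integral_integral_swap]
  · congr 1; ext ω; congr 1; ext ξ
    rw [inner_add_right, mul_add, Complex.ofReal_add, add_mul, Complex.exp_add]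
    ring
  · have h2 : Integrable (fun q : E × Ω => 𝓕⁻ η q.1 * κ q.2) (volume.prod μ) :=
      (𝓕⁻ η).integrable.mul_prod hκ
    have h3 : Measurable (fun q : E × Ω =>
        Complex.exp (↑(-2 * Real.pi * inner ℝ q.1 x) * Complex.I) *
        Complex.exp (↑(-2 * Real.pi * inner ℝ q.1 (Y q.2)) * Complex.I)) := by fun_prop
    refine (h2.bdd_mul (c := 1) h3.aestronglyMeasurable (Eventually.of_forall ?_)).congr
      (Eventually.of_forall ?_)
    · intro q
      rw [norm_mul, Complex.norm_exp_ofReal_mul_I, Complex.norm_exp_ofReal_mul_I, one_mul]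
    · intro q
      simp only [Function.uncurry]
      ring

/-- A multiplier that is the Fourier transform of an integrable density along a map `Y` acts on
`L^p` with norm at most the total mass of the density. -/
theorem exists_Lp_fourierMultiplier {p : ℝ≥0∞} [hp : Fact (1 ≤ p)] {μ : Measure Ω} [SFinite μ]
    {κ : Ω → ℂ} (hκ : Integrable κ μ) {Y : Ω → E} (hY : Measurable Y) {m : E → ℂ}
    (hm : m.HasTemperateGrowth)
    (hmk : ∀ ξ, m ξ = ∫ ω, Complex.exp (↑(-2 * Real.pi * inner ℝ ξ (Y ω)) * Complex.I) * κ ω ∂μ)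
    (g : Lp ℂ p (volume : Measure E)) :
    ∃ h : Lp ℂ p (volume : Measure E),
      (h : 𝓢'(E, ℂ)) = TemperedDistribution.fourierMultiplierCLM ℂ m (g : 𝓢'(E, ℂ)) ∧
        ‖h‖ ≤ (∫ ω, ‖κ ω‖ ∂μ) * ‖g‖ := by
  have hgm : StronglyMeasurable (g : E → ℂ) := Lp.stronglyMeasurable g
  set h : E → ℂ := fun x => ∫ ω, κ ω * g (x - Y ω) ∂μ with hdef
  have hprod : AEStronglyMeasurable (fun q : E × Ω => κ q.2 * g (q.1 - Y q.2))
      ((volume : Measure E).prod μ) :=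
    hκ.1.comp_snd.mul (hgm.comp_measurable
      (measurable_fst.sub (hY.comp measurable_snd))).aestronglyMeasurable
  have hhm : AEStronglyMeasurable h volume := hprod.integral_prod_right'
  have hκe : AEMeasurable (fun ω => ‖κ ω‖ₑ) μ := hκ.1.enorm
  have hfin : ∫⁻ ω, ‖κ ω‖ₑ ∂μ ≠ ∞ := hκ.2.ne
  have hnorm : eLpNorm h p volume ≤ (∫⁻ ω, ‖κ ω‖ₑ ∂μ) * eLpNorm g p volume := by
    -- Minkowski is applied with respect to `|κ| μ`, whose total mass is the asserted norm.
    set ν := μ.withDensity (fun ω => ‖κ ω‖ₑ) with hν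
    have hνu : ν Set.univ = ∫⁻ ω, ‖κ ω‖ₑ ∂μ := by simp [hν]
    have h1 := eLpNorm_lintegral_translate_le hp.out (ν := ν) hY hgm.enorm
      (by rw [hνu]; exact hfin)
    rw [hνu, eLpNorm_enorm] at h1
    refine le_trans ?_ h1
    refine eLpNorm_mono_enorm fun x => ?_
    rw [enorm_eq_self]
    calc ‖h x‖ₑ ≤ ∫⁻ ω, ‖κ ω * g (x - Y ω)‖ₑ ∂μ := enorm_integral_le_lintegral_enorm _
      _ = _ := by
        rw [hν, lintegral_withDensity_eq_lintegral_mul₀ hκe (g := fun ω => ‖g (x - Y ω)‖ₑ)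
          (hgm.enorm.comp (measurable_const.sub hY)).aemeasurable]
        simp [enorm_mul]
  have hmem : MemLp h p volume :=
    ⟨hhm, hnorm.trans_lt (ENNReal.mul_lt_top hfin.lt_top (Lp.eLpNorm_lt_top g))⟩
  refine ⟨hmem.toLp h, ?_, ?_⟩
  · ext η
    rw [Lp.toTemperedDistribution_apply, TemperedDistribution.fourierMultiplierCLM_apply_apply,
      Lp.toTemperedDistribution_apply]
    have hη : AEStronglyMeasurable (η : E → ℂ) volume := η.continuous.aestronglyMeasurable
    set C := eLpNorm (η : E → ℂ) (1 - p⁻¹)⁻¹ volume * eLpNorm g p volume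
    have hC : C ≠ ∞ := (ENNReal.mul_lt_top (η.eLpNorm_lt_top _ _) (Lp.eLpNorm_lt_top g)).ne
    -- Integrating in `x` before `ω` lets Hölder against the Schwartz function justify both uses of
    -- Fubini for every `p`.
    have bound : ∀ F : E × Ω → ℂ, AEStronglyMeasurable F ((volume : Measure E).prod μ) →
        (∀ ω, ∫⁻ x, ‖F (x, ω)‖ₑ ≤ ‖κ ω‖ₑ * C) → Integrable F ((volume : Measure E).prod μ) := by
      intro F hFm hF
      refine ⟨hFm, ?_⟩
      rw [HasFiniteIntegral, lintegral_prod_symm _ hFm.enorm]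
      calc _ ≤ ∫⁻ ω, ‖κ ω‖ₑ * C ∂μ := lintegral_mono hF
        _ = (∫⁻ ω, ‖κ ω‖ₑ ∂μ) * C := lintegral_mul_const'' _ hκe
        _ < ∞ := ENNReal.mul_lt_top hfin.lt_top hC.lt_top
    have I1 : Integrable (fun q : E × Ω => η q.1 * (κ q.2 * g (q.1 - Y q.2)))
        ((volume : Measure E).prod μ) := by
      refine bound _ (hη.comp_fst.mul hprod) fun ω => ?_
      have : ∀ x, ‖η x * (κ ω * g (x - Y ω))‖ₑ = ‖κ ω‖ₑ * (‖η x‖ₑ * ‖g (x - Y ω)‖ₑ) := by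
        intro x; simp only [enorm_mul]; ring
      simp only [this]
      rw [lintegral_const_mul' _ _ enorm_ne_top]
      gcongr
      rw [← lintegral_add_right_eq_self _ (Y ω)]
      simpa using lintegral_mul_translate_le hp.out hη hgm.aestronglyMeasurable (Y ω)
    have I2 : Integrable (fun q : E × Ω => κ q.2 * η (q.1 + Y q.2) * g q.1)
        ((volume : Measure E).prod μ) := by
      refine bound _ ((hκ.1.comp_snd.mul ?_).mul hgm.aestronglyMeasurable.comp_fst) fun ω => ?_
      · exact (η.continuous.measurable.comp
          (measurable_fst.add (hY.comp measurable_snd))).aestronglyMeasurable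
      have : ∀ x, ‖κ ω * η (x + Y ω) * g x‖ₑ = ‖κ ω‖ₑ * (‖η (x + Y ω)‖ₑ * ‖g x‖ₑ) := by
        intro x; simp only [enorm_mul]; ring
      simp only [this]
      rw [lintegral_const_mul' _ _ enorm_ne_top]
      gcongr
      exact lintegral_mul_translate_le hp.out hη hgm.aestronglyMeasurable (Y ω)
    calc ∫ x, η x • (hmem.toLp h) x = ∫ x, ∫ ω, η x * (κ ω * g (x - Y ω)) ∂μ := by
          refine integral_congr_ae ?_
          filter_upwards [hmem.coeFn_toLp] with x hx
          rw [hx, smul_eq_mul, integral_const_mul]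
      _ = ∫ ω, (∫ x, η x * (κ ω * g (x - Y ω))) ∂μ := integral_integral_swap I1
      _ = ∫ ω, (∫ x, κ ω * η (x + Y ω) * g x) ∂μ := by
          congr 1; ext ω
          rw [← integral_add_right_eq_self _ (Y ω)]
          congr 1; ext x
          rw [add_sub_cancel_right]; ring
      _ = ∫ x, ∫ ω, κ ω * η (x + Y ω) * g x ∂μ := (integral_integral_swap I2).symm
      _ = _ := by
          congr 1; ext x
          rw [integral_mul_const, fourier_smulLeft_fourierInv_eq_integral hκ hY hm hmk, smul_eq_mul]
  · rw [Lp.norm_toLp, Lp.norm_def, integral_norm_eq_lintegral_enorm hκ.1, ← ENNReal.toReal_mul]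
    exact ENNReal.toReal_mono (ENNReal.mul_lt_top hfin.lt_top (Lp.eLpNorm_lt_top g)).ne hnorm

end Kernel

/-! ### Calculus of Fourier multipliers on distributions and on `L^p`. -/

section Multiplier

variable {n : ℕ}

theorem convHat_convHat {m₁ m₂ : SpaceTime n → ℂ} (h₁ : m₁.HasTemperateGrowth)
    (h₂ : m₂.HasTemperateGrowth) (f : 𝓢'(SpaceTime n, ℂ)) :
    convHat m₂ (convHat m₁ f) = convHat (m₁ * m₂) f :=
  TemperedDistribution.fourierMultiplierCLM_fourierMultiplierCLM_apply h₁ h₂ f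

theorem convHat_comm {m₁ m₂ : SpaceTime n → ℂ} (h₁ : m₁.HasTemperateGrowth)
    (h₂ : m₂.HasTemperateGrowth) (f : 𝓢'(SpaceTime n, ℂ)) :
    convHat m₂ (convHat m₁ f) = convHat m₁ (convHat m₂ f) := by
  rw [convHat_convHat h₁ h₂, convHat_convHat h₂ h₁, mul_comm]

theorem convHat_add {m₁ m₂ : SpaceTime n → ℂ} (h₁ : m₁.HasTemperateGrowth)
    (h₂ : m₂.HasTemperateGrowth) (f : 𝓢'(SpaceTime n, ℂ)) :
    convHat (m₁ + m₂) f = convHat m₁ f + convHat m₂ f := by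
  simp [convHat, TemperedDistribution.fourierMultiplierCLM_apply,
    TemperedDistribution.smulLeftCLM_add h₁ h₂, FourierTransform.fourierInv_add]

theorem convHat_smul {m : SpaceTime n → ℂ} (h : m.HasTemperateGrowth) (c : ℂ)
    (f : 𝓢'(SpaceTime n, ℂ)) : convHat (c • m) f = c • convHat m f := by
  simp [convHat, TemperedDistribution.fourierMultiplierCLM_smul h]

theorem convHat_sum {ι : Type*} {m : ι → SpaceTime n → ℂ} {s : Finset ι}
    (h : ∀ i ∈ s, (m i).HasTemperateGrowth) (f : 𝓢'(SpaceTime n, ℂ)) :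
    convHat (∑ i ∈ s, m i) f = ∑ i ∈ s, convHat (m i) f := by
  have := congrArg (fun T => T f) (TemperedDistribution.fourierMultiplierCLM_sum ℂ h)
  simp only [sum_apply] at this
  have hs : (∑ i ∈ s, m i) = fun z => ∑ i ∈ s, m i z := by
    ext z
    simp
  rw [hs]
  exact this

theorem continuous_convHat (m : SpaceTime n → ℂ) : Continuous (convHat m) :=
  (TemperedDistribution.fourierMultiplierCLM ℂ m).continuous

theorem convHat_add_right (m : SpaceTime n → ℂ) (f g : 𝓢'(SpaceTime n, ℂ)) :
    convHat m (f + g) = convHat m f + convHat m g :=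
  map_add (TemperedDistribution.fourierMultiplierCLM ℂ m) f g

theorem convHat_sum_right {ι : Type*} (m : SpaceTime n → ℂ) (s : Finset ι)
    (f : ι → 𝓢'(SpaceTime n, ℂ)) : convHat m (∑ i ∈ s, f i) = ∑ i ∈ s, convHat m (f i) :=
  map_sum (TemperedDistribution.fourierMultiplierCLM ℂ m) f s

theorem convHat_smul_right (m : SpaceTime n → ℂ) (c : ℂ) (f : 𝓢'(SpaceTime n, ℂ)) :
    convHat m (c • f) = c • convHat m f :=
  map_smul (TemperedDistribution.fourierMultiplierCLM ℂ m) c f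

/-- The multiplier with symbol `m` is bounded on `L^p` with norm at most `C`. -/
structure IsLpMultiplier (p : ℝ≥0∞) [Fact (1 ≤ p)] (m : SpaceTime n → ℂ) (C : ℝ) : Prop where
  temperate : m.HasTemperateGrowth
  bound : ∀ g : Lp ℂ p (volume : Measure (SpaceTime n)),
    ∃ h : Lp ℂ p (volume : Measure (SpaceTime n)),
      (h : 𝓢'(SpaceTime n, ℂ)) = convHat m (g : 𝓢'(SpaceTime n, ℂ)) ∧ ‖h‖ ≤ C * ‖g‖

variable {p : ℝ≥0∞} [Fact (1 ≤ p)]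

theorem Lp_coe_add (g h : Lp ℂ p (volume : Measure (SpaceTime n))) :
    ((g + h : Lp ℂ p (volume : Measure (SpaceTime n))) : 𝓢'(SpaceTime n, ℂ)) = g + h :=
  map_add (Lp.toTemperedDistributionCLM ℂ volume p) g h

theorem Lp_coe_sub (g h : Lp ℂ p (volume : Measure (SpaceTime n))) :
    ((g - h : Lp ℂ p (volume : Measure (SpaceTime n))) : 𝓢'(SpaceTime n, ℂ)) = g - h :=
  map_sub (Lp.toTemperedDistributionCLM ℂ volume p) g h

theorem Lp_coe_smul (c : ℂ) (g : Lp ℂ p (volume : Measure (SpaceTime n))) :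
    ((c • g : Lp ℂ p (volume : Measure (SpaceTime n))) : 𝓢'(SpaceTime n, ℂ)) =
      c • (g : 𝓢'(SpaceTime n, ℂ)) :=
  map_smul (Lp.toTemperedDistributionCLM ℂ volume p) c g

theorem continuous_Lp_coe :
    Continuous (fun g : Lp ℂ p (volume : Measure (SpaceTime n)) => (g : 𝓢'(SpaceTime n, ℂ))) :=
  (Lp.toTemperedDistributionCLM ℂ volume p).continuous

theorem Lp_coe_injective :
    Function.Injective
      (fun g : Lp ℂ p (volume : Measure (SpaceTime n)) => (g : 𝓢'(SpaceTime n, ℂ))) :=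
  LinearMap.ker_eq_bot.1 (Lp.ker_toTemperedDistributionCLM_eq_bot (F := ℂ) (p := p)
    (μ := (volume : Measure (SpaceTime n))))

namespace IsLpMultiplier

variable {m m₁ m₂ : SpaceTime n → ℂ} {C C₁ C₂ : ℝ}

theorem mono (h : IsLpMultiplier p m C₁) (hC : C₁ ≤ C₂) : IsLpMultiplier p m C₂ := by
  refine ⟨h.temperate, fun g => ?_⟩
  obtain ⟨k, hk, hb⟩ := h.bound g
  exact ⟨k, hk, hb.trans (by gcongr)⟩

theorem add (h₁ : IsLpMultiplier p m₁ C₁) (h₂ : IsLpMultiplier p m₂ C₂) :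
    IsLpMultiplier p (m₁ + m₂) (C₁ + C₂) := by
  refine ⟨h₁.temperate.add h₂.temperate, fun g => ?_⟩
  obtain ⟨k₁, hk₁, hb₁⟩ := h₁.bound g
  obtain ⟨k₂, hk₂, hb₂⟩ := h₂.bound g
  refine ⟨k₁ + k₂, ?_, ?_⟩
  · rw [Lp_coe_add, hk₁, hk₂, convHat_add h₁.temperate h₂.temperate]
  · linarith [norm_add_le k₁ k₂]

theorem smul (h : IsLpMultiplier p m C) (c : ℂ) : IsLpMultiplier p (c • m) (‖c‖ * C) := by
  have ht : (c • m).HasTemperateGrowth := (Function.HasTemperateGrowth.const c).mul h.temperate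
  refine ⟨ht, fun g => ?_⟩
  obtain ⟨k, hk, hb⟩ := h.bound g
  refine ⟨c • k, ?_, ?_⟩
  · rw [Lp_coe_smul, hk, convHat_smul h.temperate]
  · rw [norm_smul, mul_assoc]; gcongr

theorem mul (h₁ : IsLpMultiplier p m₁ C₁) (h₂ : IsLpMultiplier p m₂ C₂) (hC : 0 ≤ C₂) :
    IsLpMultiplier p (m₁ * m₂) (C₁ * C₂) := by
  refine ⟨h₁.temperate.mul h₂.temperate, fun g => ?_⟩
  obtain ⟨k₁, hk₁, hb₁⟩ := h₁.bound g
  obtain ⟨k₂, hk₂, hb₂⟩ := h₂.bound k₁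
  refine ⟨k₂, ?_, ?_⟩
  · rw [hk₂, hk₁, convHat_convHat h₁.temperate h₂.temperate]
  · calc ‖k₂‖ ≤ C₂ * (C₁ * ‖g‖) := by linarith [mul_le_mul_of_nonneg_left hb₁ hC]
      _ = _ := by ring

end IsLpMultiplier

end Multiplier

/-! ### The regularized symbol of the half-order time derivative. -/

section HalfSymbol

variable {n : ℕ}

/-- The smooth approximation `(ε² + τ²)^{1/4}` of `|τ|^{1/2}`. -/
def halfSymbol (ε : ℝ) (z : SpaceTime n) : ℂ :=
  (((ε ^ 2 + timePart z ^ 2) ^ (1 / 4 : ℝ) : ℝ) : ℂ)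

theorem hasTemperateGrowth_timePart : (timePart : SpaceTime n → ℝ).HasTemperateGrowth :=
  (EuclideanSpace.proj (𝕜 := ℝ) (Fin.last n) : SpaceTime n →L[ℝ] ℝ).hasTemperateGrowth

theorem hasTemperateGrowth_halfSymbol {ε : ℝ} (hε : 0 < ε) :
    (halfSymbol ε : SpaceTime n → ℂ).HasTemperateGrowth := by
  have h0 : (fun z : SpaceTime n => ε⁻¹ * timePart z).HasTemperateGrowth :=
    (Function.HasTemperateGrowth.const _).mul hasTemperateGrowth_timePart
  have h1 := (Function.hasTemperateGrowth_one_add_norm_sq_rpow ℝ (1 / 4)).comp h0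
  have h2 : (fun z : SpaceTime n => (ε ^ 2 + timePart z ^ 2) ^ (1 / 4 : ℝ)) =
      fun z => (ε ^ 2) ^ (1 / 4 : ℝ) * (1 + ‖ε⁻¹ * timePart z‖ ^ 2) ^ (1 / 4 : ℝ) := by
    ext z
    rw [← Real.mul_rpow (by positivity) (by positivity)]
    congr 1
    rw [Real.norm_eq_abs, sq_abs]
    field_simp
  have h3 : (fun z : SpaceTime n => (ε ^ 2 + timePart z ^ 2) ^ (1 / 4 : ℝ)).HasTemperateGrowth := by
    rw [h2]
    exact (Function.HasTemperateGrowth.const _).mul h1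
  exact Function.Complex.hasTemperateGrowth_ofReal.comp h3

/-- The Gamma integral turns the inner integral into `(1/4)(l + a)^{-3/4}`, the derivative in `l` of
`(l + a)^{1/4}`. With `a = τ²` this exhibits the difference of two regularized symbols as a positive
mixture of Gaussians in `τ`. -/
theorem integral_rpow_mul_exp_sub {δ ε : ℝ} (hδ : 0 < δ) (hδε : δ ≤ ε) (a : ℝ) (ha : 0 ≤ a) :
    ∫ l in Set.Ioc (δ ^ 2) (ε ^ 2), ∫ s in Set.Ioi (0 : ℝ),
      (4 * Real.Gamma (3 / 4))⁻¹ * (s ^ (3 / 4 - 1 : ℝ) * Real.exp (-((l + a) * s))) =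
    (ε ^ 2 + a) ^ (1 / 4 : ℝ) - (δ ^ 2 + a) ^ (1 / 4 : ℝ) := by
  have hG : Real.Gamma (3 / 4) ≠ 0 := (Real.Gamma_pos_of_pos (by norm_num)).ne'
  have hle : δ ^ 2 ≤ ε ^ 2 := by gcongr
  have hδ2 : 0 < δ ^ 2 := by positivity
  have h1 : ∀ l ∈ Set.Ioc (δ ^ 2) (ε ^ 2), ∫ s in Set.Ioi (0 : ℝ),
      (4 * Real.Gamma (3 / 4))⁻¹ * (s ^ (3 / 4 - 1 : ℝ) * Real.exp (-((l + a) * s))) =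
      1 / 4 * (l + a) ^ (1 / 4 - 1 : ℝ) := by
    intro l hl
    have hla : 0 < l + a := by linarith [hl.1]
    rw [integral_const_mul, Real.integral_rpow_mul_exp_neg_mul_Ioi (by norm_num) hla, one_div,
      Real.inv_rpow hla.le, ← Real.rpow_neg hla.le]
    field_simp
    norm_num
  rw [setIntegral_congr_fun measurableSet_Ioc h1, ← intervalIntegral.integral_of_le hle]
  refine intervalIntegral.integral_eq_sub_of_hasDerivAt
    (f := fun l => (l + a) ^ (1 / 4 : ℝ)) ?_ ?_
  · intro l hl
    rw [Set.uIcc_of_le hle] at hl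
    have hla : 0 < l + a := by linarith [hl.1]
    simpa using ((hasDerivAt_id l).add_const a).rpow_const (p := 1 / 4) (Or.inl hla.ne')
  · refine ContinuousOn.intervalIntegrable ?_
    intro l hl
    rw [Set.uIcc_of_le hle] at hl
    have hla : 0 < l + a := by linarith [hl.1]
    exact (((continuousAt_id.add continuousAt_const).rpow_const
      (Or.inl hla.ne')).const_mul _).continuousWithinAt

theorem integrable_rpow_mul_exp {δ ε : ℝ} (hδ : 0 < δ) :
    Integrable (fun q : ℝ × ℝ => (4 * Real.Gamma (3 / 4))⁻¹ *
        (q.2 ^ (3 / 4 - 1 : ℝ) * Real.exp (-(q.1 * q.2))))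
      ((volume.restrict (Set.Ioc (δ ^ 2) (ε ^ 2))).prod (volume.restrict (Set.Ioi 0))) := by
  have hδ2 : 0 < δ ^ 2 := by positivity
  have h1 : Integrable (fun s : ℝ => s ^ (3 / 4 - 1 : ℝ) * Real.exp (-(δ ^ 2 * s)))
      (volume.restrict (Set.Ioi 0)) := by
    have h := Real.integral_rpow_mul_exp_neg_mul_Ioi (a := 3 / 4) (by norm_num) hδ2
    -- A non-integrable function has Bochner integral `0`, but the Gamma formula gives a positive
    -- value.
    by_contra hcon
    rw [integral_undef hcon] at h
    have : 0 < (1 / δ ^ 2) ^ (3 / 4 : ℝ) * Real.Gamma (3 / 4) :=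
      mul_pos (by positivity) (Real.Gamma_pos_of_pos (by norm_num))
    linarith
  have h2 := h1.comp_snd (volume.restrict (Set.Ioc (δ ^ 2) (ε ^ 2)))
  refine Integrable.const_mul ?_ _
  refine h2.mono' (by fun_prop) ?_
  rw [Measure.prod_restrict]
  filter_upwards [ae_restrict_mem (measurableSet_Ioc.prod measurableSet_Ioi)] with q hq
  have hq1 : δ ^ 2 < q.1 := hq.1.1
  have hq2 : 0 < q.2 := hq.2
  rw [Real.norm_of_nonneg (by positivity)]
  gcongr

/-- The representing measure is positive, so the norm bound is its mass, read off by putting `τ = 0`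
in the Gaussian mixture. -/
theorem isLpMultiplier_halfSymbol_sub_of_le {p : ℝ≥0∞} [Fact (1 ≤ p)] {δ ε : ℝ} (hδ : 0 < δ)
    (hδε : δ ≤ ε) :
    IsLpMultiplier p (halfSymbol ε - halfSymbol δ : SpaceTime n → ℂ) (√ε - √δ) := by
  have hε : 0 < ε := hδ.trans_le hδε
  have hm : (halfSymbol ε - halfSymbol δ : SpaceTime n → ℂ).HasTemperateGrowth :=
    (hasTemperateGrowth_halfSymbol hε).sub (hasTemperateGrowth_halfSymbol hδ)
  set μ₀ := (volume.restrict (Set.Ioc (δ ^ 2) (ε ^ 2))).prod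
    (volume.restrict (Set.Ioi (0 : ℝ))) with hμ₀
  set k : ℝ × ℝ → ℝ := fun q => (4 * Real.Gamma (3 / 4))⁻¹ *
    (q.2 ^ (3 / 4 - 1 : ℝ) * Real.exp (-(q.1 * q.2))) with hk
  have hkint : Integrable k μ₀ := integrable_rpow_mul_exp hδ
  have hG : 0 < Real.Gamma (3 / 4) := Real.Gamma_pos_of_pos (by norm_num)
  have hkpos : ∀ᵐ q ∂μ₀, 0 ≤ k q := by
    rw [hμ₀, Measure.prod_restrict]
    filter_upwards [ae_restrict_mem (measurableSet_Ioc.prod measurableSet_Ioi)] with q hq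
    have hq2 : 0 < q.2 := hq.2
    positivity
  have key : ∀ a : ℝ, 0 ≤ a → ∫ q, k q * Real.exp (-(q.2 * a)) ∂μ₀ =
      (ε ^ 2 + a) ^ (1 / 4 : ℝ) - (δ ^ 2 + a) ^ (1 / 4 : ℝ) := by
    intro a ha
    rw [← integral_rpow_mul_exp_sub hδ hδε a ha, integral_prod]
    · congr 1; ext l; congr 1; ext s
      rw [hk, mul_assoc, mul_assoc, ← Real.exp_add]
      congr 3
      ring
    · refine hkint.mul_bdd (c := 1) (by fun_prop) ?_
      rw [Measure.prod_restrict]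
      filter_upwards [ae_restrict_mem (measurableSet_Ioc.prod measurableSet_Ioi)] with q hq
      have hq2 : 0 < q.2 := hq.2
      rw [Real.norm_of_nonneg (Real.exp_nonneg _), Real.exp_le_one_iff]
      have := mul_nonneg hq2.le ha
      linarith
  set γ := ProbabilityTheory.gaussianReal 0 1
  set κ : (ℝ × ℝ) × ℝ → ℂ := fun ω => (k ω.1 : ℂ) with hκdef
  have hκ : Integrable κ (μ₀.prod γ) := (hkint.ofReal (𝕜 := ℂ)).comp_fst γ
  -- For a standard normal `y`, `√(2s) y` has characteristic function `e^{-sτ²}` at `τ`; the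
  -- division by `2π` matches the normalization of the Fourier transform. Translations are in time
  -- only.
  set Y : (ℝ × ℝ) × ℝ → SpaceTime n := fun ω =>
    (√(2 * ω.1.2) * ω.2 / (2 * Real.pi)) • EuclideanSpace.single (Fin.last n) (1 : ℝ) with hYdef
  have hY : Measurable Y := by
    refine Measurable.smul_const ?_ _
    fun_prop
  have hmass : ∫ ω, ‖κ ω‖ ∂(μ₀.prod γ) = √ε - √δ := by
    have h0 := key 0 le_rfl
    have h4 : ∀ t : ℝ, 0 < t → (t ^ 2 + 0) ^ (1 / 4 : ℝ) = √t := by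
      intro t ht
      rw [add_zero, Real.sqrt_eq_rpow, ← Real.rpow_natCast, ← Real.rpow_mul ht.le]
      norm_num
    rw [h4 _ hε, h4 _ hδ] at h0
    rw [← h0, integral_prod _ hκ.norm]
    refine integral_congr_ae ?_
    filter_upwards [hkpos] with q hq
    simp [hκdef, abs_of_nonneg hq]
  have hmk : ∀ ξ : SpaceTime n, (halfSymbol ε - halfSymbol δ : SpaceTime n → ℂ) ξ =
      ∫ ω, Complex.exp (↑(-2 * Real.pi * inner ℝ ξ (Y ω)) * Complex.I) * κ ω ∂(μ₀.prod γ) := by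
    intro ξ
    have hint : Integrable (fun ω =>
        Complex.exp (↑(-2 * Real.pi * inner ℝ ξ (Y ω)) * Complex.I) * κ ω) (μ₀.prod γ) := by
      refine hκ.bdd_mul (c := 1) ?_ (Eventually.of_forall fun ω => ?_)
      · exact (Measurable.aestronglyMeasurable (by fun_prop))
      · rw [Complex.norm_exp_ofReal_mul_I]
    rw [integral_prod _ hint]
    have h5 : ∀ᵐ q ∂μ₀, ∫ y, Complex.exp (↑(-2 * Real.pi * inner ℝ ξ (Y (q, y))) * Complex.I) *
        κ (q, y) ∂γ = ((k q * Real.exp (-(q.2 * timePart ξ ^ 2)) : ℝ) : ℂ) := by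
      rw [hμ₀, Measure.prod_restrict]
      filter_upwards [ae_restrict_mem (measurableSet_Ioc.prod measurableSet_Ioi)] with q hq
      have hq2 : 0 < q.2 := hq.2
      have h6 := ProbabilityTheory.charFun_gaussianReal (μ := 0) (v := 1)
        (-(√(2 * q.2) * timePart ξ))
      rw [charFun_apply_real] at h6
      change ∫ y, Complex.exp (↑(-2 * Real.pi * inner ℝ ξ (Y (q, y))) * Complex.I) *
        ((k q : ℝ) : ℂ) ∂γ = _
      rw [integral_mul_const, mul_comm, Complex.ofReal_mul (k q)]
      congr 1
      have h7 : ∀ y : ℝ, (-2 * Real.pi * inner ℝ ξ (Y (q, y))) =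
          -(√(2 * q.2) * timePart ξ) * y := by
        intro y
        simp only [hYdef, inner_smul_right, EuclideanSpace.inner_single_right, timePart]
        simp
        field_simp
      simp only [h7]
      have h8 : (√(2 * q.2)) ^ 2 = 2 * q.2 := Real.sq_sqrt (by positivity)
      have h9 : Complex.exp (↑(-(√(2 * q.2) * timePart ξ)) * ↑(0 : ℝ) * Complex.I -
          ↑(1 : ℝ≥0) * ↑(-(√(2 * q.2) * timePart ξ)) ^ 2 / 2) =
          ((Real.exp (-(q.2 * timePart ξ ^ 2)) : ℝ) : ℂ) := by
        rw [Complex.ofReal_exp]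
        congr 1
        have : -(q.2 * timePart ξ ^ 2) = -((-(√(2 * q.2) * timePart ξ)) ^ 2 / 2) := by
          rw [neg_sq, mul_pow, h8]; ring
        rw [this]
        push_cast
        simp
      rw [← h9, ← h6]
      congr 1; ext y
      push_cast
      ring_nf
    rw [integral_congr_ae h5, integral_complex_ofReal, key _ (sq_nonneg _)]
    simp [halfSymbol]
  refine ⟨hm, fun g => ?_⟩
  obtain ⟨h, hh, hb⟩ := exists_Lp_fourierMultiplier hκ hY hm hmk g
  exact ⟨h, hh, by rwa [hmass] at hb⟩

theorem isLpMultiplier_halfSymbol_sub {p : ℝ≥0∞} [Fact (1 ≤ p)] {δ ε : ℝ} (hδ : 0 < δ)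
    (hε : 0 < ε) :
    IsLpMultiplier p (halfSymbol ε - halfSymbol δ : SpaceTime n → ℂ) |√ε - √δ| := by
  rcases le_total δ ε with h | h
  · rw [abs_of_nonneg (sub_nonneg.2 (Real.sqrt_le_sqrt h))]
    exact isLpMultiplier_halfSymbol_sub_of_le hδ h
  · rw [abs_of_nonpos (sub_nonpos.2 (Real.sqrt_le_sqrt h))]
    have := (isLpMultiplier_halfSymbol_sub_of_le (n := n) (p := p) hε h).smul (-1)
    simpa using this

end HalfSymbol

/-! ### Parabolic dilations, the gauge, and dilated Schwartz symbols. -/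

section Dilation

variable {n : ℕ}

theorem dilate_apply_castSucc (r : ℝ) (z : SpaceTime n) (k : Fin n) :
    dilate r z k.castSucc = r * z k.castSucc := by simp [dilate]

theorem dilate_apply_last (r : ℝ) (z : SpaceTime n) :
    dilate r z (Fin.last n) = r ^ 2 * z (Fin.last n) := by simp [dilate]

theorem timePart_dilate (r : ℝ) (z : SpaceTime n) : timePart (dilate r z) = r ^ 2 * timePart z :=
  dilate_apply_last r z

theorem spacePart_dilate (r : ℝ) (z : SpaceTime n) : spacePart (dilate r z) = r • spacePart z := by
  ext k
  simp [spacePart, dilate]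

theorem dilate_dilate (r s : ℝ) (z : SpaceTime n) : dilate r (dilate s z) = dilate (r * s) z := by
  ext j
  refine Fin.lastCases ?_ (fun k => ?_) j
  · simp only [dilate_apply_last]; ring
  · simp only [dilate_apply_castSucc]; ring

/-- The parabolic dilation as a linear map. -/
def dilateCLM (r : ℝ) : SpaceTime n →L[ℝ] SpaceTime n :=
  LinearMap.toContinuousLinearMap
    { toFun := dilate r
      map_add' := fun x y => by
        ext j
        refine Fin.lastCases ?_ (fun k => ?_) j
        · simp only [dilate_apply_last, PiLp.add_apply]; ring
        · simp only [dilate_apply_castSucc, PiLp.add_apply]; ring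
      map_smul' := fun c x => by
        ext j
        refine Fin.lastCases ?_ (fun k => ?_) j
        · simp only [dilate_apply_last, PiLp.smul_apply, smul_eq_mul, RingHom.id_apply]; ring
        · simp only [dilate_apply_castSucc, PiLp.smul_apply, smul_eq_mul, RingHom.id_apply]; ring }

theorem continuous_dilate (r : ℝ) : Continuous (dilate r : SpaceTime n → SpaceTime n) :=
  (dilateCLM r).continuous

theorem norm_sq_eq (z : SpaceTime n) : ‖z‖ ^ 2 = ‖spacePart z‖ ^ 2 + timePart z ^ 2 := by
  rw [EuclideanSpace.norm_sq_eq, EuclideanSpace.norm_sq_eq, Fin.sum_univ_castSucc]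
  simp [spacePart, timePart]

theorem inner_dilate (r : ℝ) (y z : SpaceTime n) :
    inner ℝ y (dilate r z) = inner ℝ (dilate r y) z := by
  simp only [PiLp.inner_apply, Fin.sum_univ_castSucc, dilate_apply_castSucc, dilate_apply_last]
  congr 1
  · refine Finset.sum_congr rfl fun k _ => ?_
    simp; ring
  · simp; ring

theorem norm_dilate_le {r : ℝ} (hr : 0 ≤ r) (hr1 : r ≤ 1) (z : SpaceTime n) :
    ‖dilate r z‖ ≤ ‖z‖ := by
  refine le_of_sq_le_sq ?_ (norm_nonneg _)
  rw [norm_sq_eq, norm_sq_eq, spacePart_dilate, timePart_dilate, norm_smul, Real.norm_of_nonneg hr,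
    mul_pow, mul_pow]
  have h2 : r ^ 2 ≤ 1 := pow_le_one₀ hr hr1
  have h4 : (r ^ 2) ^ 2 ≤ 1 := pow_le_one₀ (by positivity) h2
  gcongr
  · exact mul_le_of_le_one_left (by positivity) h2
  · exact mul_le_of_le_one_left (by positivity) h4

theorem norm_dilateCLM_le {r : ℝ} (hr : 0 ≤ r) (hr1 : r ≤ 1) :
    ‖(dilateCLM r : SpaceTime n →L[ℝ] SpaceTime n)‖ ≤ 1 :=
  ContinuousLinearMap.opNorm_le_bound _ zero_le_one fun z => by
    rw [one_mul]; exact norm_dilate_le hr hr1 z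

theorem gauge_dilate {r : ℝ} (hr : 0 ≤ r) (z : SpaceTime n) :
    gauge (dilate r z) = r * gauge z := by
  rw [gauge, gauge, spacePart_dilate, timePart_dilate, norm_smul, Real.norm_of_nonneg hr, abs_mul,
    Real.sqrt_mul (abs_nonneg _), abs_of_nonneg (sq_nonneg r), Real.sqrt_sq hr]
  ring

theorem norm_spacePart_le (z : SpaceTime n) : ‖spacePart z‖ ≤ ‖z‖ := by
  refine le_of_sq_le_sq ?_ (norm_nonneg _)
  rw [norm_sq_eq]; nlinarith [sq_nonneg (timePart z)]

theorem abs_timePart_le (z : SpaceTime n) : |timePart z| ≤ ‖z‖ := by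
  refine le_of_sq_le_sq ?_ (norm_nonneg _)
  rw [norm_sq_eq, sq_abs]; nlinarith [sq_nonneg ‖spacePart z‖]

theorem continuous_spacePart : Continuous (spacePart : SpaceTime n → EuclideanSpace ℝ (Fin n)) := by
  refine (PiLp.continuous_toLp 2 _).comp (continuous_pi fun k => ?_)
  exact (EuclideanSpace.proj (𝕜 := ℝ) k.castSucc : SpaceTime n →L[ℝ] ℝ).continuous

theorem continuous_timePart : Continuous (timePart : SpaceTime n → ℝ) :=
  (EuclideanSpace.proj (𝕜 := ℝ) (Fin.last n) : SpaceTime n →L[ℝ] ℝ).continuous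

theorem continuous_gauge : Continuous (gauge : SpaceTime n → ℝ) :=
  continuous_spacePart.norm.add continuous_timePart.abs.sqrt

theorem gauge_nonneg (z : SpaceTime n) : 0 ≤ gauge z := by unfold gauge; positivity

theorem gauge_le (z : SpaceTime n) : gauge z ≤ 2 * (1 + ‖z‖) := by
  have h1 := norm_spacePart_le z
  have h2 : √|timePart z| ≤ 1 + ‖z‖ := by
    rw [Real.sqrt_le_left (by positivity)]
    nlinarith [abs_timePart_le z, norm_nonneg z]
  unfold gauge
  linarith

theorem norm_le_gauge (z : SpaceTime n) : ‖z‖ ≤ gauge z + gauge z ^ 2 := by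
  have h0 : 0 ≤ √|timePart z| := Real.sqrt_nonneg _
  have h1 : √|timePart z| ^ 2 = |timePart z| := Real.sq_sqrt (abs_nonneg _)
  have h2 : ‖z‖ ≤ ‖spacePart z‖ + |timePart z| := by
    refine le_of_sq_le_sq ?_ (by positivity)
    rw [norm_sq_eq]
    nlinarith [norm_nonneg (spacePart z), abs_nonneg (timePart z), sq_abs (timePart z),
      mul_nonneg (norm_nonneg (spacePart z)) (abs_nonneg (timePart z))]
  unfold gauge
  nlinarith [norm_nonneg (spacePart z), mul_nonneg (norm_nonneg (spacePart z)) h0]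

theorem gauge_zero : gauge (0 : SpaceTime n) = 0 := by
  have h : dilate 0 (0 : SpaceTime n) = 0 := map_zero (dilateCLM 0)
  rw [← h, gauge_dilate le_rfl, zero_mul]

theorem hasCompactSupport_of_gauge {χ : SpaceTime n → ℂ} {R : ℝ}
    (h : ∀ z, R ≤ gauge z → χ z = 0) : HasCompactSupport χ := by
  refine HasCompactSupport.intro (isCompact_closedBall 0 (R + R ^ 2)) fun z hz => h z ?_
  by_contra hlt
  push Not at hlt
  apply hz
  rw [mem_closedBall_zero_iff]
  have := gauge_nonneg z
  refine (norm_le_gauge z).trans ?_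
  gcongr

theorem halfSymbol_dilate {r : ℝ} (hr : 0 < r) (ε : ℝ) (z : SpaceTime n) :
    halfSymbol ε (dilate r z) = r * halfSymbol (ε / r ^ 2) z := by
  simp only [halfSymbol, timePart_dilate]
  rw [← Complex.ofReal_mul]
  congr 1
  have h1 : ε ^ 2 + (r ^ 2 * timePart z) ^ 2 = r ^ 4 * ((ε / r ^ 2) ^ 2 + timePart z ^ 2) := by
    field_simp
  rw [h1, Real.mul_rpow (by positivity) (by positivity)]
  congr 1
  rw [← Real.rpow_natCast, ← Real.rpow_mul hr.le]
  norm_num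

variable {p : ℝ≥0∞} [Fact (1 ≤ p)]

theorem hasTemperateGrowth_comp_dilate {m : SpaceTime n → ℂ} (hm : m.HasTemperateGrowth) (r : ℝ) :
    (fun z => m (dilate r z)).HasTemperateGrowth :=
  hm.comp (dilateCLM r).hasTemperateGrowth

/-- The parabolic dilates of a Schwartz symbol are uniformly bounded multipliers on `L^p`. -/
theorem exists_isLpMultiplier_dilate (p : ℝ≥0∞) [Fact (1 ≤ p)] (χ : 𝓢(SpaceTime n, ℂ)) :
    ∃ C : ℝ, 0 ≤ C ∧ ∀ r : ℝ, IsLpMultiplier p (fun z => χ (dilate r z)) C := by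
  -- Dilating the symbol only moves the translation points to `dilate r v`; the density `𝓕⁻ χ` and
  -- hence the mass do not depend on `r`.
  refine ⟨∫ x, ‖𝓕⁻ χ x‖, by positivity, fun r => ?_⟩
  have hm := hasTemperateGrowth_comp_dilate χ.hasTemperateGrowth r
  refine ⟨hm, fun g => ?_⟩
  refine exists_Lp_fourierMultiplier (𝓕⁻ χ).integrable (continuous_dilate r).measurable hm ?_ g
  intro ξ
  have h1 : 𝓕 (𝓕⁻ χ) (dilate r ξ) = χ (dilate r ξ) := by
    rw [FourierTransform.fourier_fourierInv_eq]
  rw [← h1, SchwartzMap.fourier_coe, Real.fourier_eq']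
  simp only [smul_eq_mul, inner_dilate]
  congr 1; ext v
  rw [real_inner_comm, inner_dilate]

/-- Compare `ε` with the regularization `r⁻²` natural to the scale. The difference of the two
symbols has norm `|√ε - r⁻¹| ≤ r⁻¹`, and `halfSymbol r⁻²` times the cutoff is `r⁻¹` times a dilate
of the fixed Schwartz function `halfSymbol 1 · χ`. The bound does not degenerate as `ε → 0`. -/
theorem exists_isLpMultiplier_halfSymbol_mul (p : ℝ≥0∞) [Fact (1 ≤ p)] (χ : 𝓢(SpaceTime n, ℂ)) :
    ∃ C : ℝ, 0 ≤ C ∧ ∀ r ε : ℝ, 0 < r → 0 < ε → ε ≤ (r ^ 2)⁻¹ →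
      IsLpMultiplier p (halfSymbol ε * fun z => χ (dilate r z)) (r⁻¹ * C) := by
  have h1 := hasTemperateGrowth_halfSymbol (n := n) one_pos
  obtain ⟨C₁, hC₁, H₁⟩ := exists_isLpMultiplier_dilate p χ
  obtain ⟨C₂, hC₂, H₂⟩ := exists_isLpMultiplier_dilate p (SchwartzMap.smulLeftCLM ℂ (halfSymbol 1) χ)
  refine ⟨C₁ + C₂, by positivity, fun r ε hr hε hεr => ?_⟩
  have hr2 : 0 < (r ^ 2)⁻¹ := by positivity
  have hs : √((r ^ 2)⁻¹) = r⁻¹ := by rw [Real.sqrt_inv, Real.sqrt_sq hr.le]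
  have h3 := (isLpMultiplier_halfSymbol_sub (n := n) (p := p) hr2 hε).mul (H₁ r) hC₁
  have h4 := (H₂ r).smul (r⁻¹ : ℝ)
  have h5 := h3.add h4
  have e : (halfSymbol ε - halfSymbol (r ^ 2)⁻¹ : SpaceTime n → ℂ) * (fun z => χ (dilate r z)) +
      ((r⁻¹ : ℝ) : ℂ) • (fun z => SchwartzMap.smulLeftCLM ℂ (halfSymbol 1) χ (dilate r z)) =
      halfSymbol ε * fun z => χ (dilate r z) := by
    ext z
    have h6 := halfSymbol_dilate hr 1 z
    rw [one_div] at h6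
    simp only [Pi.add_apply, Pi.mul_apply, Pi.sub_apply, Pi.smul_apply, smul_eq_mul,
      SchwartzMap.smulLeftCLM_apply_apply h1, h6]
    have : (r : ℂ) ≠ 0 := by exact_mod_cast hr.ne'
    push_cast
    field_simp
    ring
  rw [e] at h5
  refine h5.mono ?_
  rw [hs, mul_add]
  have h7 : |√ε - r⁻¹| ≤ r⁻¹ := by
    have : √ε ≤ r⁻¹ := by rw [← hs]; exact Real.sqrt_le_sqrt hεr
    rw [abs_le]
    constructor <;> linarith [Real.sqrt_nonneg ε, inv_pos.2 hr]
  have h8 : ‖((r⁻¹ : ℝ) : ℂ)‖ = r⁻¹ := by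
    rw [Complex.norm_real, Real.norm_of_nonneg (by positivity)]
  rw [h8]
  gcongr

theorem norm_iteratedFDeriv_comp_dilate_le (χ : 𝓢(SpaceTime n, ℂ)) {r : ℝ} (hr : 0 ≤ r)
    (hr1 : r ≤ 1) (j : ℕ) (z : SpaceTime n) :
    ‖iteratedFDeriv ℝ j (fun z => χ (dilate r z)) z‖ ≤ SchwartzMap.seminorm ℝ 0 j χ := by
  have h := (dilateCLM r : SpaceTime n →L[ℝ] SpaceTime n).iteratedFDeriv_comp_right (i := j)
    (χ.smooth ⊤) z (by exact_mod_cast le_top)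
  change ‖iteratedFDeriv ℝ j (χ ∘ dilateCLM r) z‖ ≤ _
  rw [h]
  refine (ContinuousMultilinearMap.norm_compContinuousLinearMap_le _ _).trans ?_
  have h2 : ∏ _i : Fin j, ‖(dilateCLM r : SpaceTime n →L[ℝ] SpaceTime n)‖ ≤ 1 :=
    Finset.prod_le_one (fun _ _ => norm_nonneg _) fun _ _ => norm_dilateCLM_le hr hr1
  calc _ ≤ ‖iteratedFDeriv ℝ j χ (dilateCLM r z)‖ * 1 := by gcongr
    _ ≤ _ := by rw [mul_one]; exact SchwartzMap.norm_iteratedFDeriv_le_seminorm ℝ χ j _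

/-- Cutting a Schwartz function off at a large scale changes it little. -/
theorem tendsto_smulLeftCLM_dilate {χ : 𝓢(SpaceTime n, ℂ)} (hχ : ∀ z, gauge z < 1 → χ z = 1)
    {r : ℕ → ℝ} (hr : ∀ J, 0 < r J) (hr1 : ∀ J, r J ≤ 1) (hr0 : Tendsto r atTop (𝓝 0))
    (ζ : 𝓢(SpaceTime n, ℂ)) :
    Tendsto (fun J => SchwartzMap.smulLeftCLM ℂ (fun z => χ (dilate (r J) z)) ζ) atTop (𝓝 ζ) := by
  rw [(schwartz_withSeminorms ℝ (SpaceTime n) ℂ).tendsto_nhds]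
  rintro ⟨k, l⟩
  simp only [SchwartzMap.schwartzSeminormFamily_apply]
  set S : ℕ → ℕ → ℝ := fun a b => SchwartzMap.seminorm ℝ a b ζ
  set A : ℕ → ℝ := fun b => S k b + S (k + 1) b
  set M : ℝ := ∑ i ∈ Finset.range (l + 1), (l.choose i : ℝ) * SchwartzMap.seminorm ℝ 0 i χ *
    A (l - i) + A l with hM
  have hA : ∀ b, 0 ≤ A b := fun b => add_nonneg (apply_nonneg _ _) (apply_nonneg _ _)
  have hM0 : 0 ≤ M := add_nonneg (Finset.sum_nonneg fun i _ =>
    mul_nonneg (mul_nonneg (by positivity) (apply_nonneg _ _)) (hA _)) (hA _)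
  have hζ : ∀ b z, ‖z‖ ^ k * ((1 + ‖z‖) * ‖iteratedFDeriv ℝ b ζ z‖) ≤ A b := by
    intro b z
    have h1 := SchwartzMap.le_seminorm ℝ k b ζ z
    have h2 := SchwartzMap.le_seminorm ℝ (k + 1) b ζ z
    calc _ = ‖z‖ ^ k * ‖iteratedFDeriv ℝ b ζ z‖ + ‖z‖ ^ (k + 1) * ‖iteratedFDeriv ℝ b ζ z‖ := by
          ring
      _ ≤ _ := add_le_add h1 h2
  have key : ∀ J, SchwartzMap.seminorm ℝ k l
      (SchwartzMap.smulLeftCLM ℂ (fun z => χ (dilate (r J) z)) ζ - ζ) ≤ 2 * r J * M := by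
    intro J
    have hrJ := hr J
    have ht := hasTemperateGrowth_comp_dilate χ.hasTemperateGrowth (r J)
    refine SchwartzMap.seminorm_le_bound ℝ k l _ (by positivity) fun z => ?_
    rcases lt_or_ge (r J * gauge z) 1 with hz | hz
    -- The cutoff is identically `1` near `z`, so all derivatives of the difference vanish.
    · have h0 : (⇑(SchwartzMap.smulLeftCLM ℂ (fun z => χ (dilate (r J) z)) ζ - ζ)) =ᶠ[𝓝 z]
          fun _ => 0 := by
        filter_upwards [(isOpen_lt ((continuous_gauge (n := n)).const_mul (r J))
          continuous_const).mem_nhds hz] with w hw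
        have : χ (dilate (r J) w) = 1 := hχ _ (by rwa [gauge_dilate (hr J).le])
        simp [SchwartzMap.smulLeftCLM_apply_apply ht, this]
      rw [(h0.iteratedFDeriv ℝ l).eq_of_nhds]
      simp only [iteratedFDeriv_fun_zero, Pi.zero_apply, norm_zero, mul_zero]
      positivity
    -- Far out, one more power of `1 + ‖z‖`, absorbed by the seminorms of `ζ`, buys the small factor
    -- `r J`.
    · have h1 : 1 ≤ 2 * r J * (1 + ‖z‖) := by
        have := mul_le_mul_of_nonneg_left (gauge_le z) hrJ.le
        linarith
      have h2 : ‖iteratedFDeriv ℝ l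
          (⇑(SchwartzMap.smulLeftCLM ℂ (fun z => χ (dilate (r J) z)) ζ - ζ)) z‖ ≤
          ∑ i ∈ Finset.range (l + 1), (l.choose i : ℝ) * SchwartzMap.seminorm ℝ 0 i χ *
            ‖iteratedFDeriv ℝ (l - i) ζ z‖ + ‖iteratedFDeriv ℝ l ζ z‖ := by
        have e : (⇑(SchwartzMap.smulLeftCLM ℂ (fun z => χ (dilate (r J) z)) ζ - ζ)) =
            ((fun w => χ (dilate (r J) w) * ζ w) - ζ : SpaceTime n → ℂ) := by
          ext w; simp [SchwartzMap.smulLeftCLM_apply_apply ht]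
        rw [e, iteratedFDeriv_sub_apply]
        · refine (norm_sub_le _ _).trans ?_
          gcongr
          refine (norm_iteratedFDeriv_mul_le (n := l) (N := ((⊤ : ℕ∞) : WithTop ℕ∞)) ht.1 (ζ.smooth ⊤) z
            (by exact_mod_cast le_top)).trans ?_
          gcongr with i hi
          exact norm_iteratedFDeriv_comp_dilate_le χ hrJ.le (hr1 J) i z
        · exact ((ht.1.mul (ζ.smooth ⊤)).of_le (by exact_mod_cast le_top)).contDiffAt
        · exact ζ.contDiffAt l
      calc _ ≤ ‖z‖ ^ k * (∑ i ∈ Finset.range (l + 1), (l.choose i : ℝ) *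
            SchwartzMap.seminorm ℝ 0 i χ *
            ‖iteratedFDeriv ℝ (l - i) ζ z‖ + ‖iteratedFDeriv ℝ l ζ z‖) * 1 := by
            rw [mul_one]; gcongr
        _ ≤ ‖z‖ ^ k * (∑ i ∈ Finset.range (l + 1), (l.choose i : ℝ) *
            SchwartzMap.seminorm ℝ 0 i χ *
            ‖iteratedFDeriv ℝ (l - i) ζ z‖ + ‖iteratedFDeriv ℝ l ζ z‖) *
              (2 * r J * (1 + ‖z‖)) := by
            refine mul_le_mul_of_nonneg_left h1 ?_
            exact mul_nonneg (by positivity) (add_nonneg (Finset.sum_nonneg fun i _ =>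
              mul_nonneg (mul_nonneg (by positivity) (apply_nonneg _ _)) (norm_nonneg _))
              (norm_nonneg _))
        _ = 2 * r J * (∑ i ∈ Finset.range (l + 1), (l.choose i : ℝ) *
            SchwartzMap.seminorm ℝ 0 i χ *
            (‖z‖ ^ k * ((1 + ‖z‖) * ‖iteratedFDeriv ℝ (l - i) ζ z‖)) +
            ‖z‖ ^ k * ((1 + ‖z‖) * ‖iteratedFDeriv ℝ l ζ z‖)) := by
            rw [mul_add (‖z‖ ^ k), add_mul, Finset.mul_sum, Finset.sum_mul,
              mul_add (2 * r J) (Finset.sum _ _), Finset.mul_sum]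
            congr 1
            · exact Finset.sum_congr rfl fun i _ => by ring
            · ring
        _ ≤ 2 * r J * M := by
            rw [hM]
            refine mul_le_mul_of_nonneg_left ?_ (by positivity)
            refine add_le_add (Finset.sum_le_sum fun i _ => ?_) (hζ l z)
            exact mul_le_mul_of_nonneg_left (hζ _ z) (mul_nonneg (by positivity) (apply_nonneg _ _))
  intro ε hε
  have hlim : Tendsto (fun J => 2 * r J * M) atTop (𝓝 0) := by
    simpa using (hr0.const_mul 2).mul_const M
  filter_upwards [hlim.eventually_lt_const hε] with J hJ
  exact (key J).trans_lt hJ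

theorem tendsto_convHat_dilate {χ : 𝓢(SpaceTime n, ℂ)} (hχ : ∀ z, gauge z < 1 → χ z = 1)
    {r : ℕ → ℝ} (hr : ∀ J, 0 < r J) (hr1 : ∀ J, r J ≤ 1) (hr0 : Tendsto r atTop (𝓝 0))
    (f : 𝓢'(SpaceTime n, ℂ)) :
    Tendsto (fun J => convHat (fun z => χ (dilate (r J) z)) f) atTop (𝓝 f) := by
  rw [PointwiseConvergenceCLM.tendsto_iff_forall_tendsto]
  intro η
  simp only [convHat, TemperedDistribution.fourierMultiplierCLM_apply_apply]
  have h := tendsto_smulLeftCLM_dilate hχ hr hr1 hr0 (𝓕⁻ η)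
  have h3 := (f.continuous.comp (FourierTransform.fourierCLM ℂ 𝓢(SpaceTime n, ℂ)).continuous).tendsto
    (𝓕⁻ η)
  have h4 : 𝓕 (𝓕⁻ η) = η := FourierTransform.fourier_fourierInv_eq η
  simp only [Function.comp_apply, FourierTransform.fourierCLM_apply, h4] at h3
  exact h3.comp h

end Dilation

/-! ### The dyadic resolution of unity and division by the parabolic polynomial. -/

section Resolution

variable {n : ℕ} {φ : 𝓢(SpaceTime n, ℂ)}

theorem hasTemperateGrowth_phiHat (φ : 𝓢(SpaceTime n, ℂ)) (i : ℤ) :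
    (phiHat φ i).HasTemperateGrowth :=
  hasTemperateGrowth_comp_dilate (𝓕 φ).hasTemperateGrowth _

theorem phiHat_dilate (φ : 𝓢(SpaceTime n, ℂ)) (i j : ℤ) (z : SpaceTime n) :
    phiHat φ j (dilate ((2 : ℝ) ^ (-i)) z) = phiHat φ (j + i) z := by
  rw [phiHat, phiHat, dilate_dilate, ← zpow_add₀ two_ne_zero, neg_add]

theorem IsGenerator.phiHat_eq_zero (hφ : IsGenerator φ) {i : ℤ} {z : SpaceTime n}
    (h : ¬((2 : ℝ) ^ (i - 1) < gauge z ∧ gauge z < (2 : ℝ) ^ (i + 1))) : phiHat φ i z = 0 := by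
  refine hφ.zero _ fun hz => h ?_
  rw [gauge_dilate (by positivity), zpow_neg] at hz
  have h2 : (0 : ℝ) < 2 ^ i := by positivity
  rw [zpow_sub₀ two_ne_zero, zpow_add₀ two_ne_zero, zpow_one]
  obtain ⟨h3, h4⟩ := hz
  rw [lt_inv_mul_iff₀ h2] at h3
  rw [inv_mul_lt_iff₀ h2] at h4
  exact ⟨by linarith, h4⟩

theorem IsGenerator.phiHat_eq_zero_of_le (hφ : IsGenerator φ) {i : ℤ} {z : SpaceTime n}
    (h : gauge z ≤ (2 : ℝ) ^ (i - 1)) : phiHat φ i z = 0 :=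
  hφ.phiHat_eq_zero fun hz => absurd hz.1 (not_lt.2 h)

theorem IsGenerator.phiHat_eq_zero_of_ge (hφ : IsGenerator φ) {i : ℤ} {z : SpaceTime n}
    (h : (2 : ℝ) ^ (i + 1) ≤ gauge z) : phiHat φ i z = 0 :=
  hφ.phiHat_eq_zero fun hz => absurd hz.2 (not_lt.2 h)

/-- The symbol `φ̂_{i-1} + φ̂_i + φ̂_{i+1}`, which is `1` on the support of `φ̂_i`. -/
def fatPhi (φ : 𝓢(SpaceTime n, ℂ)) (i : ℤ) (z : SpaceTime n) : ℂ :=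
  phiHat φ (i - 1) z + phiHat φ i z + phiHat φ (i + 1) z

theorem hasTemperateGrowth_fatPhi (φ : 𝓢(SpaceTime n, ℂ)) (i : ℤ) :
    (fatPhi φ i).HasTemperateGrowth :=
  ((hasTemperateGrowth_phiHat φ _).add (hasTemperateGrowth_phiHat φ _)).add
    (hasTemperateGrowth_phiHat φ _)

theorem fatPhi_dilate (φ : 𝓢(SpaceTime n, ℂ)) (i : ℤ) (z : SpaceTime n) :
    fatPhi φ 0 (dilate ((2 : ℝ) ^ (-i)) z) = fatPhi φ i z := by
  simp only [fatPhi, phiHat_dilate]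
  rw [show (0 : ℤ) - 1 + i = i - 1 by ring, zero_add, zero_add, add_comm 1 i]

theorem IsGenerator.fatPhi_mul_phiHat (hφ : IsGenerator φ) (i : ℤ) :
    fatPhi φ i * phiHat φ i = phiHat φ i := by
  ext z
  by_cases hz : phiHat φ i z = 0
  · simp [hz]
  have hg : (2 : ℝ) ^ (i - 1) < gauge z ∧ gauge z < (2 : ℝ) ^ (i + 1) := by
    by_contra hcon
    exact hz (hφ.phiHat_eq_zero hcon)
  have hz0 : z ≠ 0 := by
    rintro rfl
    rw [gauge_zero] at hg
    exact absurd hg.1 (not_lt.2 (by positivity))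
  have h1 : HasSum (fun j : ℤ => phiHat φ j z)
      (∑ j ∈ ({i - 1, i, i + 1} : Finset ℤ), phiHat φ j z) := by
    refine hasSum_sum_of_ne_finset_zero fun j hj => ?_
    simp only [Finset.mem_insert, Finset.mem_singleton, not_or] at hj
    rcases lt_or_ge j i with h | h
    · refine hφ.phiHat_eq_zero_of_ge (le_trans ?_ hg.1.le)
      exact zpow_le_zpow_right₀ one_le_two (by omega)
    · refine hφ.phiHat_eq_zero_of_le (hg.2.le.trans ?_)
      exact zpow_le_zpow_right₀ one_le_two (by omega)
  have h2 := h1.unique (hφ.sum_eq_one z hz0)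
  rw [Finset.sum_insert (by simp; omega), Finset.sum_insert (by simp), Finset.sum_singleton] at h2
  rw [Pi.mul_apply, fatPhi, add_assoc, h2, one_mul]

theorem IsGenerator.psiHat_eq_sub_sum (hφ : IsGenerator φ) {J : ℕ} {z : SpaceTime n}
    (h : gauge z ≤ 2 ^ J) :
    psiHat φ z = 1 - ∑ i ∈ Finset.range J, phiHat φ ((i : ℤ) + 1) z := by
  rw [psiHat, tsum_eq_sum (s := Finset.range J)]
  intro i hi
  refine hφ.phiHat_eq_zero_of_le (h.trans ?_)
  rw [add_sub_cancel_right, zpow_natCast]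
  exact pow_le_pow_right₀ one_le_two (by simpa using hi)

theorem IsGenerator.psiHat_eq_one (hφ : IsGenerator φ) {z : SpaceTime n} (h : gauge z ≤ 1) :
    psiHat φ z = 1 := by
  simpa using hφ.psiHat_eq_sub_sum (J := 0) (by simpa using h)

/-- The pieces of index at most `0` vanish here, so those of index at least `1` already sum to `1`.
-/
theorem IsGenerator.psiHat_eq_zero (hφ : IsGenerator φ) {z : SpaceTime n} (h : 2 ≤ gauge z) :
    psiHat φ z = 0 := by
  have hz0 : z ≠ 0 := by
    rintro rfl
    rw [gauge_zero] at h
    linarith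
  have hinj : Function.Injective (fun i : ℕ => (i : ℤ) + 1) := fun a b hab => by
    simpa using hab
  have h1 : HasSum (fun i : ℕ => phiHat φ ((i : ℤ) + 1) z) 1 := by
    refine (hinj.hasSum_iff (f := fun j : ℤ => phiHat φ j z) fun j hj => ?_).2
      (hφ.sum_eq_one z hz0)
    refine hφ.phiHat_eq_zero_of_ge (le_trans ?_ h)
    have hj0 : j + 1 ≤ 1 := by
      by_contra hcon
      exact hj ⟨(j - 1).toNat, by simp; omega⟩
    simpa using zpow_le_zpow_right₀ (one_le_two (α := ℝ)) hj0
  rw [psiHat, h1.tsum_eq, sub_self]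

/-- The partial sums of the resolution are dilates of one cutoff; this is what makes them converge
on distributions. -/
theorem IsGenerator.psiHat_dilate (hφ : IsGenerator φ) (J : ℕ) (z : SpaceTime n) :
    psiHat φ (dilate ((2 : ℝ) ^ (-(J : ℤ))) z) =
      psiHat φ z + ∑ i ∈ Finset.range J, phiHat φ ((i : ℤ) + 1) z := by
  have hs : Summable (fun i : ℕ => phiHat φ ((i : ℤ) + 1) z) := by
    obtain ⟨K, hK⟩ := pow_unbounded_of_one_lt (gauge z) (one_lt_two (α := ℝ))
    refine summable_of_ne_finset_zero (s := Finset.range K) fun i hi => ?_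
    refine hφ.phiHat_eq_zero_of_le (hK.le.trans ?_)
    rw [add_sub_cancel_right, zpow_natCast]
    exact pow_le_pow_right₀ one_le_two (by simpa using hi)
  have h := hs.sum_add_tsum_nat_add J
  rw [psiHat, psiHat, ← h]
  simp only [phiHat_dilate]
  push_cast
  have : ∀ i : ℕ, ((i : ℤ) + 1 + J) = (i : ℤ) + J + 1 := fun i => by ring
  simp only [this]
  ring

theorem IsGenerator.contDiff_psiHat (hφ : IsGenerator φ) :
    ContDiff ℝ ((⊤ : ℕ∞) : WithTop ℕ∞) (psiHat φ) := by
  rw [contDiff_iff_contDiffAt]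
  intro z
  rcases lt_or_ge (gauge z) 4 with h | h
  · have h1 : psiHat φ =ᶠ[𝓝 z]
        fun w => 1 - ∑ i ∈ Finset.range 2, phiHat φ ((i : ℤ) + 1) w := by
      filter_upwards [(isOpen_lt (continuous_gauge (n := n)) continuous_const).mem_nhds h] with w hw
      exact hφ.psiHat_eq_sub_sum (by norm_num; exact le_of_lt hw)
    refine ContDiffAt.congr_of_eventuallyEq ?_ h1
    exact contDiffAt_const.sub (ContDiffAt.sum fun i _ =>
      (hasTemperateGrowth_phiHat φ _).1.contDiffAt)
  · have h1 : psiHat φ =ᶠ[𝓝 z] fun _ => 0 := by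
      filter_upwards [(isOpen_lt continuous_const (continuous_gauge (n := n))).mem_nhds
        (show (2 : ℝ) < gauge z by linarith)] with w hw
      exact hφ.psiHat_eq_zero (le_of_lt hw)
    exact contDiffAt_const.congr_of_eventuallyEq h1

/-- The symbol of the low-frequency cutoff as a Schwartz function. -/
def psiSchwartz (hφ : IsGenerator φ) : 𝓢(SpaceTime n, ℂ) :=
  (hasCompactSupport_of_gauge fun _ h => hφ.psiHat_eq_zero h).toSchwartzMap hφ.contDiff_psiHat

theorem psiSchwartz_apply (hφ : IsGenerator φ) (z : SpaceTime n) :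
    psiSchwartz hφ z = psiHat φ z := rfl

theorem IsGenerator.hasTemperateGrowth_psiHat (hφ : IsGenerator φ) :
    (psiHat φ).HasTemperateGrowth := (psiSchwartz hφ).hasTemperateGrowth

/-- The symbol `ψ̂ + φ̂_1`, which is `1` on the support of `ψ̂`. -/
def fatPsi (φ : 𝓢(SpaceTime n, ℂ)) (z : SpaceTime n) : ℂ := psiHat φ (dilate 2⁻¹ z)

theorem IsGenerator.fatPsi_mul_psiHat (hφ : IsGenerator φ) : fatPsi φ * psiHat φ = psiHat φ := by
  ext z
  rcases lt_or_ge (gauge z) 2 with h | h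
  · have : fatPsi φ z = 1 := hφ.psiHat_eq_one (by rw [gauge_dilate (by positivity)]; linarith)
    simp [this]
  · simp [hφ.psiHat_eq_zero h]

theorem IsGenerator.tendsto_sum_convHat (hφ : IsGenerator φ) (f : 𝓢'(SpaceTime n, ℂ)) :
    Tendsto (fun J : ℕ => convHat (psiHat φ) f +
      ∑ i ∈ Finset.range J, convHat (phiHat φ ((i : ℤ) + 1)) f) atTop (𝓝 f) := by
  have h := tendsto_convHat_dilate (χ := psiSchwartz hφ)
    (fun z hz => hφ.psiHat_eq_one hz.le) (r := fun J => (2 : ℝ) ^ (-(J : ℤ)))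
    (fun J => by positivity) (fun J => zpow_le_one_of_nonpos₀ one_le_two (by simp))
    (by
      simp only [zpow_neg, zpow_natCast, ← inv_pow]
      exact tendsto_pow_atTop_nhds_zero_of_lt_one (by norm_num) (by norm_num)) f
  refine h.congr fun J => ?_
  have ht : (∑ i ∈ Finset.range J, phiHat φ ((i : ℤ) + 1)).HasTemperateGrowth := by
    convert Function.HasTemperateGrowth.sum (s := Finset.range J) fun (i : ℕ) _ =>
      hasTemperateGrowth_phiHat φ ((i : ℤ) + 1)
    simp
  rw [← convHat_sum fun i _ => hasTemperateGrowth_phiHat φ _, ← convHat_add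
    hφ.hasTemperateGrowth_psiHat ht]
  congr 1
  ext z
  rw [psiSchwartz_apply, hφ.psiHat_dilate]
  simp

/-- The parabolically homogeneous polynomial `|ξ|⁴ + τ²`. -/
def parabolicPoly (z : SpaceTime n) : ℝ := (‖spacePart z‖ ^ 2) ^ 2 + timePart z ^ 2

theorem norm_spacePart_sq (z : SpaceTime n) : ‖spacePart z‖ ^ 2 = ∑ k : Fin n, z k.castSucc ^ 2 := by
  simp [EuclideanSpace.norm_sq_eq, spacePart]

theorem hasTemperateGrowth_apply (j : Fin (n + 1)) :
    (fun z : SpaceTime n => z j).HasTemperateGrowth :=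
  (EuclideanSpace.proj (𝕜 := ℝ) j : SpaceTime n →L[ℝ] ℝ).hasTemperateGrowth

theorem hasTemperateGrowth_norm_spacePart_sq :
    (fun z : SpaceTime n => ‖spacePart z‖ ^ 2).HasTemperateGrowth := by
  simp only [norm_spacePart_sq]
  exact Function.HasTemperateGrowth.sum fun k _ => (hasTemperateGrowth_apply _).pow 2

theorem hasTemperateGrowth_parabolicPoly :
    (parabolicPoly : SpaceTime n → ℝ).HasTemperateGrowth :=
  (hasTemperateGrowth_norm_spacePart_sq.pow 2).add (hasTemperateGrowth_timePart.pow 2)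

theorem hasTemperateGrowth_ofReal_comp {a : SpaceTime n → ℝ} (ha : a.HasTemperateGrowth) :
    (fun z => (a z : ℂ)).HasTemperateGrowth :=
  Function.Complex.hasTemperateGrowth_ofReal.comp ha

theorem parabolicPoly_dilate (r : ℝ) (z : SpaceTime n) :
    parabolicPoly (dilate r z) = r ^ 4 * parabolicPoly z := by
  rw [parabolicPoly, parabolicPoly, spacePart_dilate, timePart_dilate, norm_smul, mul_pow,
    Real.norm_eq_abs, sq_abs]
  ring

theorem parabolicPoly_ne_zero {z : SpaceTime n} (h : 0 < gauge z) : parabolicPoly z ≠ 0 := by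
  intro h0
  have h1 : (‖spacePart z‖ ^ 2) ^ 2 = 0 ∧ timePart z ^ 2 = 0 := by
    unfold parabolicPoly at h0
    constructor <;> nlinarith [sq_nonneg (‖spacePart z‖ ^ 2), sq_nonneg (timePart z)]
  have h2 : ‖spacePart z‖ = 0 := by simpa using h1.1
  have h3 : timePart z = 0 := by simpa using h1.2
  simp [gauge, h2, h3] at h

theorem IsGenerator.fatPhi_zero_eq_zero (hφ : IsGenerator φ) {z : SpaceTime n}
    (h : gauge z ≤ 1 / 4 ∨ 4 ≤ gauge z) : fatPhi φ 0 z = 0 := by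
  have e : ∀ j : ℤ, -1 ≤ j → j ≤ 1 → phiHat φ j z = 0 := by
    intro j h1 h2
    rcases h with h | h
    · refine hφ.phiHat_eq_zero_of_le (h.trans ?_)
      refine le_trans ?_ (zpow_le_zpow_right₀ (one_le_two (α := ℝ)) (show -2 ≤ j - 1 by omega))
      norm_num
    · refine hφ.phiHat_eq_zero_of_ge (le_trans ?_ h)
      refine (zpow_le_zpow_right₀ (one_le_two (α := ℝ)) (show j + 1 ≤ 2 by omega)).trans ?_
      norm_num
  simp [fatPhi, e (-1) (by norm_num) (by norm_num), e 0 (by norm_num) (by norm_num),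
    e 1 (by norm_num) (by norm_num)]

/-- `fatPhi φ 0` vanishes near the origin, the only zero of the polynomial, so the quotient is
smooth with compact support. `N = 1` serves the reverse Bernstein inequality, large `N` the
existence of the half derivative. -/
theorem IsGenerator.exists_schwartz_parabolicPoly_mul (hφ : IsGenerator φ) (N : ℕ) :
    ∃ W : 𝓢(SpaceTime n, ℂ), ∀ z, (parabolicPoly z : ℂ) ^ N * W z = fatPhi φ 0 z := by
  set w : SpaceTime n → ℂ := fun z => fatPhi φ 0 z / (parabolicPoly z : ℂ) ^ N with hw
  have hc : HasCompactSupport w :=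
    hasCompactSupport_of_gauge (R := 4) fun z hz => by simp [hw, hφ.fatPhi_zero_eq_zero (Or.inr hz)]
  have hs : ContDiff ℝ ((⊤ : ℕ∞) : WithTop ℕ∞) w := by
    rw [contDiff_iff_contDiffAt]
    intro z
    rcases lt_or_ge (gauge z) (1 / 4) with h | h
    · have h1 : w =ᶠ[𝓝 z] fun _ => 0 := by
        filter_upwards [(isOpen_lt (continuous_gauge (n := n)) continuous_const).mem_nhds h]
          with v hv
        simp [hw, hφ.fatPhi_zero_eq_zero (Or.inl (le_of_lt hv))]
      exact contDiffAt_const.congr_of_eventuallyEq h1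
    · have hP := parabolicPoly_ne_zero (z := z) (by linarith)
      have hP2 : ContDiff ℝ ((⊤ : ℕ∞) : WithTop ℕ∞)
          (fun z : SpaceTime n => (parabolicPoly z : ℂ) ^ N) :=
        ((hasTemperateGrowth_ofReal_comp hasTemperateGrowth_parabolicPoly).pow N).1
      simp only [hw, div_eq_mul_inv]
      exact (hasTemperateGrowth_fatPhi φ 0).1.contDiffAt.mul
        (hP2.contDiffAt.inv (pow_ne_zero _ (by exact_mod_cast hP)))
  refine ⟨hc.toSchwartzMap hs, fun z => ?_⟩
  change (parabolicPoly z : ℂ) ^ N * w z = _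
  rcases lt_or_ge (gauge z) (1 / 4) with h | h
  · simp [hw, hφ.fatPhi_zero_eq_zero (Or.inl h.le)]
  · have hP := parabolicPoly_ne_zero (z := z) (by linarith)
    have : (parabolicPoly z : ℂ) ^ N ≠ 0 := pow_ne_zero _ (by exact_mod_cast hP)
    simp only [hw]
    field_simp

theorem IsGenerator.exists_schwartz_fatPhi (hφ : IsGenerator φ) :
    ∃ W : 𝓢(SpaceTime n, ℂ), ∀ z, W z = fatPhi φ 0 z := by
  simpa using hφ.exists_schwartz_parabolicPoly_mul 0

end Resolution

/-! ### The extended `L^p` norm of a distribution. -/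

section LpNorm

variable {n : ℕ} {p : ℝ≥0∞} [Fact (1 ≤ p)]

theorem lpENorm_coe (g : Lp ℂ p (volume : Measure (SpaceTime n))) :
    lpENorm p (g : 𝓢'(SpaceTime n, ℂ)) = ‖g‖ₑ := by
  rw [lpENorm]
  refine le_antisymm (iInf_le_of_le g (iInf_le_of_le rfl le_rfl)) (le_iInf₂ fun g' h => ?_)
  rw [Lp_coe_injective h]

theorem exists_Lp_of_lpENorm_ne_top {f : 𝓢'(SpaceTime n, ℂ)} (h : lpENorm p f ≠ ∞) :
    ∃ g : Lp ℂ p (volume : Measure (SpaceTime n)), (g : 𝓢'(SpaceTime n, ℂ)) = f := by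
  by_contra! hcon
  apply h
  simp [lpENorm, hcon]

theorem lpENorm_coe_le {g : Lp ℂ p (volume : Measure (SpaceTime n))} {C : ℝ} (hC : 0 ≤ C)
    {f : 𝓢'(SpaceTime n, ℂ)} {h : Lp ℂ p (volume : Measure (SpaceTime n))}
    (hh : (h : 𝓢'(SpaceTime n, ℂ)) = f) (hb : ‖h‖ ≤ C * ‖g‖) :
    lpENorm p f ≤ ENNReal.ofReal C * lpENorm p (g : 𝓢'(SpaceTime n, ℂ)) := by
  rw [← hh, lpENorm_coe, lpENorm_coe, ← ofReal_norm, ← ofReal_norm, ← ENNReal.ofReal_mul hC]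
  exact ENNReal.ofReal_le_ofReal hb

end LpNorm

/-! ### Convergence of the regularized half derivatives. -/

section HalfDerivative

variable {n : ℕ} {p : ℝ≥0∞} [Fact (1 ≤ p)]

theorem isHalfTimeDeriv_iff {f u : 𝓢'(SpaceTime n, ℂ)} :
    IsHalfTimeDeriv f u ↔ Tendsto (fun ε => convHat (halfSymbol ε) f) (𝓝[>] 0) (𝓝 u) := by
  constructor
  · intro h
    have h1 := ((FourierTransform.fourierInvCLM ℂ 𝓢'(SpaceTime n, ℂ)).continuous.tendsto _).comp h
    simp only [FourierTransform.fourierInvCLM_apply, FourierTransform.fourierInv_fourier_eq] at h1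
    exact h1
  · intro h
    have h1 := ((FourierTransform.fourierCLM ℂ 𝓢'(SpaceTime n, ℂ)).continuous.tendsto _).comp h
    refine h1.congr fun ε => ?_
    simp only [Function.comp_apply, FourierTransform.fourierCLM_apply, convHat,
      TemperedDistribution.fourierMultiplierCLM_apply, FourierTransform.fourier_fourierInv_eq]
    rfl

theorem eventually_mem_Ioc : ∀ᶠ ε : ℝ in 𝓝[>] 0, ε ∈ Set.Ioc (0 : ℝ) 1 :=
  Ioc_mem_nhdsGT one_pos

/-- A family in a complete space that is Lipschitz in `√ε` converges as `ε → 0⁺`. -/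
theorem exists_tendsto_of_norm_sub_le_sqrt {F : Type*} [NormedAddCommGroup F] [CompleteSpace F]
    {G : ℝ → F} {M : ℝ}
    (hG : ∀ ε ∈ Set.Ioc (0 : ℝ) 1, ∀ δ ∈ Set.Ioc (0 : ℝ) 1, ‖G ε - G δ‖ ≤ |√ε - √δ| * M) :
    ∃ h, Tendsto G (𝓝[>] 0) (𝓝 h) := by
  rw [← cauchy_map_iff_exists_tendsto, Metric.cauchy_iff]
  refine ⟨inferInstance, fun e he => ?_⟩
  have hM : 0 < |M| + 1 := by positivity
  have hs : ∀ᶠ ε : ℝ in 𝓝[>] 0, √ε < e / (|M| + 1) := by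
    have : Tendsto (fun ε : ℝ => √ε) (𝓝[>] 0) (𝓝 0) := by
      have := (Real.continuous_sqrt.tendsto 0).mono_left (nhdsWithin_le_nhds (s := Set.Ioi 0))
      simpa using this
    exact this.eventually_lt_const (by positivity)
  refine ⟨G '' {ε | ε ∈ Set.Ioc (0 : ℝ) 1 ∧ √ε < e / (|M| + 1)},
    image_mem_map (eventually_mem_Ioc.and hs), ?_⟩
  rintro _ ⟨ε, ⟨hε, hεs⟩, rfl⟩ _ ⟨δ, ⟨hδ, hδs⟩, rfl⟩
  rw [dist_eq_norm]
  have h1 : |√ε - √δ| ≤ e / (|M| + 1) := by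
    rw [abs_le]
    constructor <;> linarith [Real.sqrt_nonneg ε, Real.sqrt_nonneg δ]
  calc ‖G ε - G δ‖ ≤ |√ε - √δ| * M := hG ε hε δ hδ
    _ ≤ |√ε - √δ| * |M| := by gcongr; exact le_abs_self M
    _ ≤ e / (|M| + 1) * |M| := by gcongr
    _ < e / (|M| + 1) * (|M| + 1) := by gcongr; linarith
    _ = e := by field_simp

theorem convHat_halfSymbol_sub {ε δ : ℝ} (hε : 0 < ε) (hδ : 0 < δ) (f : 𝓢'(SpaceTime n, ℂ)) :
    convHat (halfSymbol ε - halfSymbol δ) f = convHat (halfSymbol ε) f - convHat (halfSymbol δ) f := by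
  rw [eq_sub_iff_add_eq, ← convHat_add ((hasTemperateGrowth_halfSymbol hε).sub
    (hasTemperateGrowth_halfSymbol hδ)) (hasTemperateGrowth_halfSymbol hδ), sub_add_cancel]

/-- Only the difference of `k₁` and `k₂` is prescribed, so this also covers families in which a
common distribution outside `L^p` has been subtracted. -/
theorem norm_sub_le_of_coe_sub_eq {ε δ : ℝ} (hε : 0 < ε) (hδ : 0 < δ)
    {g k₁ k₂ : Lp ℂ p (volume : Measure (SpaceTime n))}
    (h : (k₁ : 𝓢'(SpaceTime n, ℂ)) - (k₂ : 𝓢'(SpaceTime n, ℂ)) =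
      convHat (halfSymbol ε) (g : 𝓢'(SpaceTime n, ℂ)) - convHat (halfSymbol δ) g) :
    ‖k₁ - k₂‖ ≤ |√ε - √δ| * ‖g‖ := by
  obtain ⟨k, hk, hb⟩ := (isLpMultiplier_halfSymbol_sub (n := n) (p := p) hδ hε).bound g
  have : k₁ - k₂ = k := by
    apply Lp_coe_injective
    change ((k₁ - k₂ : Lp ℂ p (volume : Measure (SpaceTime n))) : 𝓢'(SpaceTime n, ℂ)) = k
    rw [Lp_coe_sub, h, hk, convHat_halfSymbol_sub hε hδ]
  rwa [this]

/-- Without localization `convHat (halfSymbol ε) g` need not lie in `L^p`, but its difference from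
the value at `ε = 1` does, and that difference is Cauchy. -/
theorem exists_tendsto_convHat_halfSymbol (g : Lp ℂ p (volume : Measure (SpaceTime n))) :
    ∃ w : 𝓢'(SpaceTime n, ℂ),
      Tendsto (fun ε => convHat (halfSymbol ε) (g : 𝓢'(SpaceTime n, ℂ))) (𝓝[>] 0) (𝓝 w) := by
  have h1 : ∀ ε : ℝ, ∃ k : Lp ℂ p (volume : Measure (SpaceTime n)), 0 < ε →
      (k : 𝓢'(SpaceTime n, ℂ)) = convHat (halfSymbol ε) (g : 𝓢'(SpaceTime n, ℂ)) -
        convHat (halfSymbol 1) g := by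
    intro ε
    by_cases hε : 0 < ε
    · obtain ⟨k, hk, -⟩ := (isLpMultiplier_halfSymbol_sub (n := n) (p := p) one_pos hε).bound g
      exact ⟨k, fun _ => by rw [hk, convHat_halfSymbol_sub hε one_pos]⟩
    · exact ⟨0, fun h => absurd h hε⟩
  choose G hG using h1
  obtain ⟨h, hh⟩ := exists_tendsto_of_norm_sub_le_sqrt (G := G) (M := ‖g‖) fun ε hε δ hδ =>
    norm_sub_le_of_coe_sub_eq hε.1 hδ.1 (by rw [hG ε hε.1, hG δ hδ.1]; abel)
  refine ⟨(h : 𝓢'(SpaceTime n, ℂ)) + convHat (halfSymbol 1) (g : 𝓢'(SpaceTime n, ℂ)), ?_⟩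
  refine (((continuous_Lp_coe.tendsto h).comp hh).add_const
    (convHat (halfSymbol 1) (g : 𝓢'(SpaceTime n, ℂ)))).congr' ?_
  filter_upwards [eventually_mem_Ioc] with ε hε
  rw [Function.comp_apply, hG ε hε.1, sub_add_cancel]

/-- On frequency-localized `L^p` functions the regularized half derivatives converge in `L^p`. -/
theorem exists_Lp_tendsto_halfSymbol {χ : SpaceTime n → ℂ} (hχ : χ.HasTemperateGrowth) {B : ℝ}
    (hB : ∀ ε ∈ Set.Ioc (0 : ℝ) 1, IsLpMultiplier p (halfSymbol ε * χ) B)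
    {g : Lp ℂ p (volume : Measure (SpaceTime n))}
    (hg : convHat χ (g : 𝓢'(SpaceTime n, ℂ)) = g) :
    ∃ (G : ℝ → Lp ℂ p (volume : Measure (SpaceTime n)))
      (h : Lp ℂ p (volume : Measure (SpaceTime n))),
      (∀ ε ∈ Set.Ioc (0 : ℝ) 1,
        (G ε : 𝓢'(SpaceTime n, ℂ)) = convHat (halfSymbol ε) (g : 𝓢'(SpaceTime n, ℂ))) ∧
      Tendsto G (𝓝[>] 0) (𝓝 h) ∧ ‖h‖ ≤ B * ‖g‖ ∧
      Tendsto (fun ε => convHat (halfSymbol ε) (g : 𝓢'(SpaceTime n, ℂ))) (𝓝[>] 0) (𝓝 h) := by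
  have h1 : ∀ ε : ℝ, ∃ k : Lp ℂ p (volume : Measure (SpaceTime n)), ε ∈ Set.Ioc (0 : ℝ) 1 →
      (k : 𝓢'(SpaceTime n, ℂ)) = convHat (halfSymbol ε) (g : 𝓢'(SpaceTime n, ℂ)) ∧
        ‖k‖ ≤ B * ‖g‖ := by
    intro ε
    by_cases hε : ε ∈ Set.Ioc (0 : ℝ) 1
    · obtain ⟨k, hk, hb⟩ := (hB ε hε).bound g
      refine ⟨k, fun _ => ⟨?_, hb⟩⟩
      rw [hk, mul_comm, ← convHat_convHat hχ (hasTemperateGrowth_halfSymbol hε.1), hg]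
    · exact ⟨0, fun h => absurd h hε⟩
  choose G hG using h1
  obtain ⟨h, hh⟩ := exists_tendsto_of_norm_sub_le_sqrt (G := G) (M := ‖g‖) fun ε hε δ hδ =>
    norm_sub_le_of_coe_sub_eq hε.1 hδ.1 (by rw [(hG ε hε).1, (hG δ hδ).1])
  refine ⟨G, h, fun ε hε => (hG ε hε).1, hh, ?_, ?_⟩
  · refine le_of_tendsto hh.norm ?_
    filter_upwards [eventually_mem_Ioc] with ε hε using (hG ε hε).2
  · refine ((continuous_Lp_coe.tendsto h).comp hh).congr' ?_
    filter_upwards [eventually_mem_Ioc] with ε hε using (hG ε hε).1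

theorem IsHalfTimeDeriv.tendsto_convHat {f u : 𝓢'(SpaceTime n, ℂ)} (h : IsHalfTimeDeriv f u)
    {X : SpaceTime n → ℂ} (hX : X.HasTemperateGrowth) :
    Tendsto (fun ε => convHat (halfSymbol ε) (convHat X f)) (𝓝[>] 0) (𝓝 (convHat X u)) := by
  refine (((continuous_convHat X).tendsto u).comp (isHalfTimeDeriv_iff.1 h)).congr' ?_
  filter_upwards [self_mem_nhdsWithin] with ε hε
  exact (convHat_comm hX (hasTemperateGrowth_halfSymbol hε) f).symm

end HalfDerivative

/-! ### Bernstein inequalities. -/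

section Derivative

variable {n : ℕ} {p : ℝ≥0∞} [Fact (1 ≤ p)]

/-- The symbol `ξ_k`. -/
def coordSymbol (k : Fin n) (z : SpaceTime n) : ℂ := (z k.castSucc : ℂ)

theorem hasTemperateGrowth_coordSymbol (k : Fin n) :
    (coordSymbol k : SpaceTime n → ℂ).HasTemperateGrowth :=
  hasTemperateGrowth_ofReal_comp (hasTemperateGrowth_apply _)

theorem spaceDeriv_eq_convHat (k : Fin n) (f : 𝓢'(SpaceTime n, ℂ)) :
    spaceDeriv k f = (2 * Real.pi * Complex.I) • convHat (coordSymbol k) f := by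
  rw [spaceDeriv, TemperedDistribution.lineDeriv_eq_fourierMultiplierCLM, convHat]
  congr 3
  ext z
  simp [coordSymbol, EuclideanSpace.inner_single_right]

theorem convHat_spaceDeriv {X : SpaceTime n → ℂ} (hX : X.HasTemperateGrowth) (k : Fin n)
    (f : 𝓢'(SpaceTime n, ℂ)) :
    convHat X (spaceDeriv k f) =
      (2 * Real.pi * Complex.I) • convHat (coordSymbol k) (convHat X f) := by
  rw [spaceDeriv_eq_convHat, convHat_smul_right, convHat_comm (hasTemperateGrowth_coordSymbol k) hX]

/-- Homogeneity: the product is `r⁻¹` times the dilate of the Schwartz function `ξ_k χ`. -/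
theorem exists_isLpMultiplier_coordSymbol_mul (p : ℝ≥0∞) [Fact (1 ≤ p)] (χ : 𝓢(SpaceTime n, ℂ))
    (k : Fin n) :
    ∃ C : ℝ, 0 ≤ C ∧ ∀ r : ℝ, 0 < r →
      IsLpMultiplier p (coordSymbol k * fun z => χ (dilate r z)) (r⁻¹ * C) := by
  obtain ⟨C, hC, H⟩ := exists_isLpMultiplier_dilate p (SchwartzMap.smulLeftCLM ℂ (coordSymbol k) χ)
  refine ⟨C, hC, fun r hr => ?_⟩
  have h := (H r).smul (r⁻¹ : ℝ)
  have h8 : ‖((r⁻¹ : ℝ) : ℂ)‖ = r⁻¹ := by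
    rw [Complex.norm_real, Real.norm_of_nonneg (by positivity)]
  rw [h8] at h
  convert h using 1
  ext z
  have : (r : ℂ) ≠ 0 := by exact_mod_cast hr.ne'
  simp only [Pi.mul_apply, Pi.smul_apply, smul_eq_mul,
    SchwartzMap.smulLeftCLM_apply_apply (hasTemperateGrowth_coordSymbol k), coordSymbol,
    dilate_apply_castSucc]
  push_cast
  field_simp

/-- Bernstein's inequality for the first order space derivatives and the half time derivative. -/
theorem exists_bernstein (p : ℝ≥0∞) [Fact (1 ≤ p)] (χ : 𝓢(SpaceTime n, ℂ)) :
    ∃ C : ℝ, 0 ≤ C ∧ ∀ (r : ℝ) (X : SpaceTime n → ℂ), 0 < r → r ≤ 1 → X.HasTemperateGrowth →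
      (fun z => χ (dilate r z)) * X = X → ∀ f : 𝓢'(SpaceTime n, ℂ),
      lpENorm p (convHat X f) ≠ ∞ →
      (∀ k, lpENorm p (convHat X (spaceDeriv k f)) ≤
        ENNReal.ofReal (r⁻¹ * C) * lpENorm p (convHat X f)) ∧
      ∀ u, IsHalfTimeDeriv f u →
        lpENorm p (convHat X u) ≤ ENNReal.ofReal (r⁻¹ * C) * lpENorm p (convHat X f) := by
  choose A hA HA using exists_isLpMultiplier_coordSymbol_mul p χ
  obtain ⟨B, hB, HB⟩ := exists_isLpMultiplier_halfSymbol_mul p χ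
  have hsum : ∀ k, A k ≤ ∑ k, A k := fun k =>
    Finset.single_le_sum (fun i _ => hA i) (Finset.mem_univ k)
  have hsum0 : 0 ≤ ∑ k, A k := Finset.sum_nonneg fun i _ => hA i
  refine ⟨2 * Real.pi * ∑ k, A k + B, by positivity, fun r X hr hr1 hX hχX f hf => ?_⟩
  have hC : 0 ≤ r⁻¹ * (2 * Real.pi * ∑ k, A k + B) := by positivity
  have hχ := hasTemperateGrowth_comp_dilate χ.hasTemperateGrowth r
  obtain ⟨g, hg⟩ := exists_Lp_of_lpENorm_ne_top hf
  have hχg : convHat (fun z => χ (dilate r z)) (g : 𝓢'(SpaceTime n, ℂ)) = g := by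
    rw [hg, convHat_convHat hX hχ, mul_comm, hχX]
  rw [← hg]
  refine ⟨fun k => ?_, fun u hu => ?_⟩
  · obtain ⟨h, hh, hb⟩ := ((HA k r hr).smul (2 * Real.pi * Complex.I)).bound g
    refine lpENorm_coe_le hC (h := h) ?_ (hb.trans ?_)
    · rw [hh, convHat_spaceDeriv hX, convHat_smul (HA k r hr).temperate, mul_comm (coordSymbol k),
        ← convHat_convHat hχ (hasTemperateGrowth_coordSymbol k), hχg, hg]
    · have : ‖(2 * Real.pi * Complex.I : ℂ)‖ = 2 * Real.pi := by
        simp [abs_of_pos Real.pi_pos]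
      rw [this]
      refine mul_le_mul_of_nonneg_right ?_ (norm_nonneg g)
      have h1 := hsum k
      calc 2 * Real.pi * (r⁻¹ * A k) = r⁻¹ * (2 * Real.pi * A k + 0) := by ring
        _ ≤ _ := by gcongr
  -- Since `r ≤ 1`, every `ε` in `(0, 1]` meets the restriction `ε ≤ r⁻²` of the uniform bound.
  · have hr2 : (1 : ℝ) ≤ (r ^ 2)⁻¹ := by
      rw [one_le_inv₀ (by positivity)]
      exact pow_le_one₀ hr.le hr1
    obtain ⟨G, h, -, -, hb, hlim⟩ := exists_Lp_tendsto_halfSymbol hχ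
      (fun ε hε => HB r ε hr hε.1 (hε.2.trans hr2)) hχg
    refine lpENorm_coe_le hC (h := h) ?_ (hb.trans ?_)
    · rw [hg] at hlim
      exact tendsto_nhds_unique hlim (hu.tendsto_convHat hX)
    · gcongr
      have : 0 ≤ 2 * Real.pi * ∑ k, A k := by positivity
      linarith

end Derivative

/-! ### The reverse Bernstein inequality. -/

section LowerBound

variable {n : ℕ} {φ : 𝓢(SpaceTime n, ℂ)}

theorem halfSymbol_pow_four (ε : ℝ) (z : SpaceTime n) :
    halfSymbol ε z ^ 4 = ((ε ^ 2 + timePart z ^ 2 : ℝ) : ℂ) := by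
  rw [halfSymbol, ← Complex.ofReal_pow, ← Real.rpow_natCast, ← Real.rpow_mul (by positivity)]
  norm_num

/-- A dyadic piece is controlled by its first order space derivatives and its half time
derivative. -/
theorem IsGenerator.exists_reverse_bernstein (hφ : IsGenerator φ) (p : ℝ≥0∞) [Fact (1 ≤ p)] :
    ∃ C : ℝ, 0 ≤ C ∧ ∀ (j : ℤ), 0 ≤ j → ∀ f u : 𝓢'(SpaceTime n, ℂ), IsHalfTimeDeriv f u →
      lpENorm p (convHat (phiHat φ j) f) ≠ ∞ →
      lpENorm p (convHat (phiHat φ j) f) ≤ ENNReal.ofReal ((2 : ℝ) ^ (-j) * C) *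
        (∑ k, lpENorm p (convHat (phiHat φ j) (spaceDeriv k f)) +
          lpENorm p (convHat (phiHat φ j) u)) := by
  obtain ⟨χ, hχ⟩ := hφ.exists_schwartz_fatPhi
  obtain ⟨W, hW⟩ := hφ.exists_schwartz_parabolicPoly_mul 1
  obtain ⟨B, -, HB⟩ := exists_bernstein p χ
  obtain ⟨H, hH, HH⟩ := exists_isLpMultiplier_halfSymbol_mul p χ
  obtain ⟨D, hD, HD⟩ := exists_isLpMultiplier_dilate p W
  set a : Fin n → SpaceTime n → ℂ := fun k z => ((‖spacePart z‖ ^ 2 : ℝ) : ℂ) * coordSymbol k z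
  have ha : ∀ k, (a k).HasTemperateGrowth := fun k =>
    (hasTemperateGrowth_ofReal_comp hasTemperateGrowth_norm_spacePart_sq).mul
      (hasTemperateGrowth_coordSymbol k)
  choose A hA HA using fun k => exists_isLpMultiplier_dilate p (SchwartzMap.smulLeftCLM ℂ (a k) W)
  have hA0 : 0 ≤ ∑ k, A k := Finset.sum_nonneg fun k _ => hA k
  have hDH : 0 ≤ D * H ^ 3 := by positivity
  refine ⟨∑ k, A k + D * H ^ 3, by positivity, fun j hj f u hu hf => ?_⟩
  set r : ℝ := (2 : ℝ) ^ (-j) with hr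
  have hr0 : 0 < r := by positivity
  have hr1 : r ≤ 1 := zpow_le_one_of_nonpos₀ one_le_two (by omega)
  have hr2 : (1 : ℝ) ≤ (r ^ 2)⁻¹ := by
    rw [one_le_inv₀ (by positivity)]
    exact pow_le_one₀ hr0.le hr1
  have hX := hasTemperateGrowth_phiHat φ j
  set X := phiHat φ j
  have hfat : (fun z => χ (dilate r z)) = fatPhi φ j := by
    ext z; rw [hχ, hr, fatPhi_dilate]
  have hχX : (fun z => χ (dilate r z)) * X = X := by rw [hfat]; exact hφ.fatPhi_mul_phiHat j
  have hχt := hasTemperateGrowth_comp_dilate χ.hasTemperateGrowth r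
  obtain ⟨HB1, HB2⟩ := HB r X hr0 hr1 hX hχX f hf
  obtain ⟨g, hg⟩ := exists_Lp_of_lpENorm_ne_top hf
  have hd : ∀ k, ∃ d : Lp ℂ p (volume : Measure (SpaceTime n)),
      (d : 𝓢'(SpaceTime n, ℂ)) = convHat X (spaceDeriv k f) := fun k =>
    exists_Lp_of_lpENorm_ne_top ((HB1 k).trans_lt
      (ENNReal.mul_lt_top ENNReal.ofReal_lt_top hf.lt_top)).ne
  choose d hd using hd
  have hχg : convHat (fun z => χ (dilate r z)) (g : 𝓢'(SpaceTime n, ℂ)) = g := by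
    rw [hg, convHat_convHat hX hχt, mul_comm, hχX]
  obtain ⟨G, h, hG, hGh, -, hlim⟩ := exists_Lp_tendsto_halfSymbol hχt
      (fun ε hε => HH r ε hr0 hε.1 (hε.2.trans hr2)) hχg
  have hh : (h : 𝓢'(SpaceTime n, ℂ)) = convHat X u := by
    rw [hg] at hlim
    exact tendsto_nhds_unique hlim (hu.tendsto_convHat hX)
  choose e he hbe using fun k => (HA k r).bound (d k)
  obtain ⟨v, hv, hbv⟩ := (HD r).bound g
  have hpi : (2 * Real.pi * Complex.I : ℂ) ≠ 0 := by
    simp [Real.pi_ne_zero]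
  have hrc : (r : ℂ) ≠ 0 := by exact_mod_cast hr0.ne'
  -- On the support of `X`, `1 = r⁴ (|ξ|⁴ + τ²) W(dilate r z)`. Write `|ξ|⁴ = ∑ (|ξ|² ξ_k) ξ_k` and
  -- `τ² = (halfSymbol ε)⁴ - ε²`; the three kinds of terms give the three summands.
  have key : ∀ ε ∈ Set.Ioc (0 : ℝ) 1, ‖g‖ ≤ r * (∑ k, A k * ‖d k‖) + r * (D * H ^ 3) * ‖G ε‖ +
      ε ^ 2 * r ^ 4 * (D * ‖g‖) := by
    intro ε hε
    have hm := hasTemperateGrowth_halfSymbol (n := n) hε.1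
    have M := HH r ε hr0 hε.1 (hε.2.trans hr2)
    have hrH : 0 ≤ r⁻¹ * H := by positivity
    -- Three of the four factors `halfSymbol ε` form a multiplier of norm at most `r⁻³ H³ D`; the
    -- fourth is already in `G ε`. With the prefactor `r⁴` this leaves one power of `r`.
    have M4 := ((M.mul M hrH).mul M hrH).mul (HD r) hD
    obtain ⟨w, hw, hbw⟩ := M4.bound (G ε)
    have hgsum : g = ∑ k, ((r : ℂ) / (2 * Real.pi * Complex.I)) • e k + (r : ℂ) ^ 4 • w +
        (-(ε : ℂ) ^ 2 * (r : ℂ) ^ 4) • v := by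
      apply Lp_coe_injective
      change (g : 𝓢'(SpaceTime n, ℂ)) = (Lp.toTemperedDistributionCLM ℂ volume p) _
      simp only [map_add, map_sum, map_smul, Lp.toTemperedDistributionCLM_apply]
      have hE : ∀ k, ((r : ℂ) / (2 * Real.pi * Complex.I)) • (e k : 𝓢'(SpaceTime n, ℂ)) =
          convHat ((r : ℂ) • (X * coordSymbol k *
            fun z => SchwartzMap.smulLeftCLM ℂ (a k) W (dilate r z))) f := by
        intro k
        have h1 : (X * coordSymbol k).HasTemperateGrowth :=
          hX.mul (hasTemperateGrowth_coordSymbol k)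
        rw [he, hd, convHat_spaceDeriv hX, convHat_convHat hX (hasTemperateGrowth_coordSymbol k),
          convHat_smul_right, convHat_convHat h1 (HA k r).temperate, smul_smul,
          div_mul_cancel₀ _ hpi, convHat_smul (h1.mul (HA k r).temperate)]
      have hE2 : ∀ k, (((r : ℂ) • (X * coordSymbol k *
            fun z => SchwartzMap.smulLeftCLM ℂ (a k) W (dilate r z))) :
              SpaceTime n → ℂ).HasTemperateGrowth := fun k =>
        (Function.HasTemperateGrowth.const (r : ℂ)).mul
          ((hX.mul (hasTemperateGrowth_coordSymbol k)).mul (HA k r).temperate)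
      have hE3 : (∑ k, ((r : ℂ) • (X * coordSymbol k *
            fun z => SchwartzMap.smulLeftCLM ℂ (a k) W (dilate r z))) :
              SpaceTime n → ℂ).HasTemperateGrowth := by
        convert Function.HasTemperateGrowth.sum (s := Finset.univ) fun k _ => hE2 k
        simp
      rw [Finset.sum_congr rfl fun k _ => hE k, ← convHat_sum fun k _ => hE2 k]
      have hXm : (X * halfSymbol ε).HasTemperateGrowth := hX.mul hm
      rw [hw, hG ε hε, hv, hg, convHat_convHat hX hm, convHat_convHat hXm M4.temperate,
        convHat_convHat hX (HD r).temperate, ← convHat_smul (hXm.mul M4.temperate),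
        ← convHat_smul (hX.mul (HD r).temperate)]
      have t1 : ((r : ℂ) ^ 4 • (X * halfSymbol ε * ((halfSymbol ε * fun z => χ (dilate r z)) *
          (halfSymbol ε * fun z => χ (dilate r z)) * (halfSymbol ε * fun z => χ (dilate r z)) *
          fun z => W (dilate r z)))).HasTemperateGrowth :=
        (Function.HasTemperateGrowth.const ((r : ℂ) ^ 4)).mul (hXm.mul M4.temperate)
      have t2 : ((-(ε : ℂ) ^ 2 * (r : ℂ) ^ 4) • (X * fun z => W (dilate r z))).HasTemperateGrowth :=
        (Function.HasTemperateGrowth.const (-(ε : ℂ) ^ 2 * (r : ℂ) ^ 4)).mul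
          (hX.mul (HD r).temperate)
      rw [← convHat_add hE3 t1, ← convHat_add (hE3.add t1) t2]
      congr 1
      ext z
      have q1 : χ (dilate r z) * X z = X z := congrFun hχX z
      have q2 := hW (dilate r z)
      rw [← hχ, parabolicPoly_dilate, parabolicPoly, pow_one] at q2
      have q3 := halfSymbol_pow_four ε z
      have q4 : (((‖spacePart z‖ ^ 2 : ℝ)) : ℂ) = ∑ k : Fin n, coordSymbol k z ^ 2 := by
        rw [norm_spacePart_sq]; simp [coordSymbol]
      have q5 : ∀ k, a k (dilate r z) = (r : ℂ) ^ 3 * ((‖spacePart z‖ ^ 2 : ℝ) : ℂ) *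
          coordSymbol k z := by
        intro k
        simp only [a, coordSymbol, spacePart_dilate, norm_smul, mul_pow, Real.norm_eq_abs, sq_abs,
          dilate_apply_castSucc]
        push_cast
        ring
      simp only [Pi.add_apply, Finset.sum_apply, Pi.smul_apply, Pi.mul_apply, smul_eq_mul,
        SchwartzMap.smulLeftCLM_apply_apply (ha _), q5]
      have q6 : ∑ k, (r : ℂ) * (X z * coordSymbol k z * ((r : ℂ) ^ 3 *
          ((‖spacePart z‖ ^ 2 : ℝ) : ℂ) * coordSymbol k z * W (dilate r z))) =
          (r : ℂ) ^ 4 * X z * ((‖spacePart z‖ ^ 2 : ℝ) : ℂ) ^ 2 * W (dilate r z) := by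
        calc _ = ∑ k, ((r : ℂ) ^ 4 * X z * ((‖spacePart z‖ ^ 2 : ℝ) : ℂ) * W (dilate r z)) *
              coordSymbol k z ^ 2 := Finset.sum_congr rfl fun k _ => by ring
          _ = _ := by rw [← Finset.mul_sum, ← q4]; ring
      rw [q6]
      push_cast at q2 q3 ⊢
      have q7 : χ (dilate r z) ^ 3 * X z = X z := by
        rw [pow_succ, mul_assoc, q1, pow_two, mul_assoc, q1, q1]
      linear_combination (-1 : ℂ) * q1 - X z * q2 -
        (r : ℂ) ^ 4 * W (dilate r z) * halfSymbol ε z ^ 4 * q7 -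
        (r : ℂ) ^ 4 * W (dilate r z) * X z * q3
    have hn1 : ‖(r : ℂ)‖ = r := by rw [Complex.norm_real, Real.norm_of_nonneg hr0.le]
    have hn2 : ‖(ε : ℂ)‖ = ε := by rw [Complex.norm_real, Real.norm_of_nonneg hε.1.le]
    have hn3 : ‖(r : ℂ) / (2 * Real.pi * Complex.I)‖ ≤ r := by
      rw [norm_div, hn1]
      have : ‖(2 * Real.pi * Complex.I : ℂ)‖ = 2 * Real.pi := by simp [abs_of_pos Real.pi_pos]
      rw [this]
      exact div_le_self hr0.le (by linarith [Real.pi_gt_three])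
    calc ‖g‖ ≤ ∑ k, ‖((r : ℂ) / (2 * Real.pi * Complex.I)) • e k‖ + ‖(r : ℂ) ^ 4 • w‖ +
          ‖(-(ε : ℂ) ^ 2 * (r : ℂ) ^ 4) • v‖ := by
          conv_lhs => rw [hgsum]
          refine (norm_add₃_le).trans ?_
          gcongr
          exact norm_sum_le _ _
      _ ≤ ∑ k, r * (A k * ‖d k‖) + r ^ 4 * (r⁻¹ * H * (r⁻¹ * H) * (r⁻¹ * H) * D * ‖G ε‖) +
          ε ^ 2 * r ^ 4 * (D * ‖g‖) := by
          simp only [norm_smul, norm_mul, norm_neg, norm_pow, hn1, hn2]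
          gcongr with k
          exact hbe k
      _ = _ := by
          rw [← Finset.mul_sum]
          field_simp
  -- Let `ε → 0⁺`: `G ε` converges to `h` in norm, and the error vanishes because `‖g‖` is finite.
  have hfin : ‖g‖ ≤ r * (∑ k, A k * ‖d k‖) + r * (D * H ^ 3) * ‖h‖ := by
    have h1 : Tendsto (fun ε : ℝ => r * (∑ k, A k * ‖d k‖) + r * (D * H ^ 3) * ‖G ε‖ +
        ε ^ 2 * r ^ 4 * (D * ‖g‖)) (𝓝[>] 0)
        (𝓝 (r * (∑ k, A k * ‖d k‖) + r * (D * H ^ 3) * ‖h‖ + 0 ^ 2 * r ^ 4 * (D * ‖g‖))) := by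
      refine (tendsto_const_nhds.add (hGh.norm.const_mul _)).add ?_
      have : Continuous fun ε : ℝ => ε ^ 2 * r ^ 4 * (D * ‖g‖) := by fun_prop
      exact (this.tendsto 0).mono_left nhdsWithin_le_nhds
    have h2 := ge_of_tendsto h1 (by filter_upwards [eventually_mem_Ioc] with ε hε using key ε hε)
    simpa using h2
  have hfin2 : ‖g‖ ≤ r * (∑ k, A k + D * H ^ 3) * (∑ k, ‖d k‖ + ‖h‖) := by
    have h1 : ∑ k, A k * ‖d k‖ ≤ (∑ k, A k) * ∑ k, ‖d k‖ := by
      rw [Finset.mul_sum]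
      gcongr with k
      exact Finset.single_le_sum (fun i _ => hA i) (Finset.mem_univ k)
    have h3 : 0 ≤ ∑ k, ‖d k‖ := Finset.sum_nonneg fun k _ => norm_nonneg _
    calc ‖g‖ ≤ r * ((∑ k, A k) * ∑ k, ‖d k‖) + r * (D * H ^ 3) * ‖h‖ := hfin.trans (by gcongr)
      _ ≤ r * ((∑ k, A k) * ∑ k, ‖d k‖) + r * (D * H ^ 3) * ‖h‖ +
          r * ((∑ k, A k) * ‖h‖ + D * H ^ 3 * ∑ k, ‖d k‖) :=
          le_add_of_nonneg_right (by positivity)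
      _ = _ := by ring
  simp only [← hg, ← hd, ← hh, lpENorm_coe, ← ofReal_norm]
  rw [← ENNReal.ofReal_sum_of_nonneg fun k _ => norm_nonneg _,
    ← ENNReal.ofReal_add (Finset.sum_nonneg fun k _ => norm_nonneg _) (norm_nonneg _),
    ← ENNReal.ofReal_mul (by positivity)]
  exact ENNReal.ofReal_le_ofReal hfin2

end LowerBound

/-! ### Summation of the dyadic estimates and equivalence of norms. -/

section BesovNorm

variable {n : ℕ} {φ : 𝓢(SpaceTime n, ℂ)} {p : ℝ≥0∞} [hp : Fact (1 ≤ p)]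

/-- The weighted norms of the dyadic pieces of a distribution. -/
def besovTerm (φ : 𝓢(SpaceTime n, ℂ)) (β : ℝ) (p : ℝ≥0∞) [Fact (1 ≤ p)]
    (f : 𝓢'(SpaceTime n, ℂ)) (i : ℕ) : ℝ≥0∞ :=
  (2 : ℝ≥0∞) ^ (β * ((i : ℝ) + 1)) * lpENorm p (convHat (phiHat φ ((i : ℤ) + 1)) f)

/-- The high-frequency part of the Besov norm. -/
def besovTail (φ : 𝓢(SpaceTime n, ℂ)) (β : ℝ) (p : ℝ≥0∞) [Fact (1 ≤ p)]
    (f : 𝓢'(SpaceTime n, ℂ)) : ℝ≥0∞ :=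
  eLpNorm (besovTerm φ β p f) p Measure.count

theorem besovENorm_of_eq_top (hpt : p = ∞) (β : ℝ) (f : 𝓢'(SpaceTime n, ℂ)) :
    besovENorm φ β p p f = max (lpENorm p (convHat (psiHat φ) f)) (besovTail φ β p f) := by
  have h : besovTail φ β p f = ⨆ i, besovTerm φ β p f i := by
    subst hpt
    rw [besovTail, eLpNorm_exponent_top, eLpNormEssSup_count]
    simp
  rw [besovENorm, if_pos hpt, h]
  rfl

theorem besovENorm_of_ne_top (hpt : p ≠ ∞) (β : ℝ) (f : 𝓢'(SpaceTime n, ℂ)) :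
    besovENorm φ β p p f = lpENorm p (convHat (psiHat φ) f) + besovTail φ β p f := by
  have hp0 : p ≠ 0 := (zero_lt_one.trans_le hp.out).ne'
  rw [besovENorm, if_neg hpt, besovTail, eLpNorm_eq_lintegral_rpow_enorm_toReal hp0 hpt,
    lintegral_count]
  rfl

theorem besovENorm_le (β : ℝ) (f : 𝓢'(SpaceTime n, ℂ)) :
    besovENorm φ β p p f ≤ lpENorm p (convHat (psiHat φ) f) + besovTail φ β p f := by
  by_cases hpt : p = ∞
  · rw [besovENorm_of_eq_top hpt]
    exact max_le le_self_add le_add_self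
  · rw [besovENorm_of_ne_top hpt]

theorem lpENorm_psiHat_le_besovENorm (β : ℝ) (f : 𝓢'(SpaceTime n, ℂ)) :
    lpENorm p (convHat (psiHat φ) f) ≤ besovENorm φ β p p f := by
  by_cases hpt : p = ∞
  · rw [besovENorm_of_eq_top hpt]; exact le_max_left _ _
  · rw [besovENorm_of_ne_top hpt]; exact le_self_add

theorem besovTail_le_besovENorm (β : ℝ) (f : 𝓢'(SpaceTime n, ℂ)) :
    besovTail φ β p f ≤ besovENorm φ β p p f := by
  by_cases hpt : p = ∞
  · rw [besovENorm_of_eq_top hpt]; exact le_max_right _ _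
  · rw [besovENorm_of_ne_top hpt]; exact le_add_self

theorem besovTerm_le_besovENorm (β : ℝ) (f : 𝓢'(SpaceTime n, ℂ)) (i : ℕ) :
    besovTerm φ β p f i ≤ besovENorm φ β p p f := by
  have hp0 : p ≠ 0 := (zero_lt_one.trans_le hp.out).ne'
  refine le_trans ?_ (besovTail_le_besovENorm β f)
  simpa [besovTail] using enorm_le_eLpNorm_count (besovTerm φ β p f) i hp0

theorem lpENorm_phiHat_ne_top {β : ℝ} {f : 𝓢'(SpaceTime n, ℂ)}
    (hf : besovENorm φ β p p f ≠ ∞) (i : ℕ) :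
    lpENorm p (convHat (phiHat φ ((i : ℤ) + 1)) f) ≠ ∞ := by
  intro h
  apply hf
  have h1 := besovTerm_le_besovENorm (φ := φ) (p := p) β f i
  have h2 : (2 : ℝ≥0∞) ^ (β * ((i : ℝ) + 1)) ≠ 0 := by simp
  rw [besovTerm, h, ENNReal.mul_top h2] at h1
  exact top_le_iff.1 h1

theorem besovTail_le_mul {β γ : ℝ} {f g : 𝓢'(SpaceTime n, ℂ)} {C : ℝ≥0}
    (h : ∀ i, besovTerm φ β p f i ≤ C * besovTerm φ γ p g i) :
    besovTail φ β p f ≤ C * besovTail φ γ p g := by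
  have := eLpNorm_le_nnreal_smul_eLpNorm_of_ae_le_mul' (μ := (Measure.count : Measure ℕ))
    (f := besovTerm φ β p f) (g := besovTerm φ γ p g) (c := C)
    (Eventually.of_forall fun i => by simpa using h i) p
  simpa [besovTail, ENNReal.smul_def] using this

theorem two_rpow_eq (α : ℝ) (i : ℕ) :
    (2 : ℝ≥0∞) ^ (α * ((i : ℝ) + 1)) =
      2 ^ ((α - 1) * ((i : ℝ) + 1)) * 2 ^ ((i : ℝ) + 1) := by
  rw [← ENNReal.rpow_add _ _ (by simp) (by simp)]
  congr 1; ring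

theorem ofReal_two_zpow (i : ℕ) :
    ENNReal.ofReal ((2 : ℝ) ^ ((i : ℤ) + 1)) = 2 ^ ((i : ℝ) + 1) := by
  have : (2 : ℝ≥0∞) = ENNReal.ofReal 2 := by simp
  rw [this, ENNReal.ofReal_rpow_of_pos two_pos, ← Real.rpow_intCast]
  push_cast
  rfl

theorem besovTerm_sub_one_le (α : ℝ) (f : 𝓢'(SpaceTime n, ℂ)) (i : ℕ) :
    besovTerm φ (α - 1) p f i ≤ besovTerm φ α p f i := by
  rw [besovTerm, besovTerm]
  gcongr
  · exact one_le_two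
  · linarith

theorem besovTerm_sub_one_le_of_bernstein {α C : ℝ} {f g : 𝓢'(SpaceTime n, ℂ)} {i : ℕ}
    (h : lpENorm p (convHat (phiHat φ ((i : ℤ) + 1)) g) ≤
      ENNReal.ofReal (((2 : ℝ) ^ (-((i : ℤ) + 1)))⁻¹ * C) *
        lpENorm p (convHat (phiHat φ ((i : ℤ) + 1)) f)) :
    besovTerm φ (α - 1) p g i ≤ C.toNNReal * besovTerm φ α p f i := by
  rw [besovTerm, besovTerm, two_rpow_eq α]
  rw [zpow_neg, inv_inv, ENNReal.ofReal_mul (by positivity), ofReal_two_zpow] at h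
  calc _ ≤ (2 : ℝ≥0∞) ^ ((α - 1) * ((i : ℝ) + 1)) * (2 ^ ((i : ℝ) + 1) * ENNReal.ofReal C *
        lpENorm p (convHat (phiHat φ ((i : ℤ) + 1)) f)) := by gcongr
    _ = ENNReal.ofReal C * ((2 : ℝ≥0∞) ^ ((α - 1) * ((i : ℝ) + 1)) * 2 ^ ((i : ℝ) + 1) *
        lpENorm p (convHat (phiHat φ ((i : ℤ) + 1)) f)) := by ring

/-- The gain `2^{-(i+1)}` turns the weight of order `α` into that of order `α - 1`; Minkowski in
`ℓ^p` then separates the derivatives. -/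
theorem besovTail_le_of_reverse_bernstein {α C : ℝ} {f u : 𝓢'(SpaceTime n, ℂ)}
    (h : ∀ i : ℕ, lpENorm p (convHat (phiHat φ ((i : ℤ) + 1)) f) ≤
      ENNReal.ofReal ((2 : ℝ) ^ (-((i : ℤ) + 1)) * C) *
        (∑ k, lpENorm p (convHat (phiHat φ ((i : ℤ) + 1)) (spaceDeriv k f)) +
          lpENorm p (convHat (phiHat φ ((i : ℤ) + 1)) u))) :
    besovTail φ α p f ≤ C.toNNReal *
      (∑ k, besovTail φ (α - 1) p (spaceDeriv k f) + besovTail φ (α - 1) p u) := by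
  have h1 : ∀ i, besovTerm φ α p f i ≤ C.toNNReal *
      (∑ k, besovTerm φ (α - 1) p (spaceDeriv k f) + besovTerm φ (α - 1) p u) i := by
    intro i
    have hi := h i
    have h2 : (2 : ℝ≥0∞) ^ ((i : ℝ) + 1) * ENNReal.ofReal ((2 : ℝ) ^ (-((i : ℤ) + 1))) = 1 := by
      rw [← ofReal_two_zpow, ← ENNReal.ofReal_mul (by positivity), zpow_neg,
        mul_inv_cancel₀ (by positivity), ENNReal.ofReal_one]
    rw [ENNReal.ofReal_mul (by positivity)] at hi
    simp only [besovTerm, Pi.add_apply, Finset.sum_apply, ← Finset.mul_sum]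
    rw [two_rpow_eq α, ← mul_add]
    calc _ ≤ (2 : ℝ≥0∞) ^ ((α - 1) * ((i : ℝ) + 1)) * 2 ^ ((i : ℝ) + 1) *
          (ENNReal.ofReal ((2 : ℝ) ^ (-((i : ℤ) + 1))) * ENNReal.ofReal C *
            (∑ k, lpENorm p (convHat (phiHat φ ((i : ℤ) + 1)) (spaceDeriv k f)) +
              lpENorm p (convHat (phiHat φ ((i : ℤ) + 1)) u))) := by gcongr
      _ = ((2 : ℝ≥0∞) ^ ((i : ℝ) + 1) * ENNReal.ofReal ((2 : ℝ) ^ (-((i : ℤ) + 1)))) *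
          (ENNReal.ofReal C * ((2 : ℝ≥0∞) ^ ((α - 1) * ((i : ℝ) + 1)) *
            (∑ k, lpENorm p (convHat (phiHat φ ((i : ℤ) + 1)) (spaceDeriv k f)) +
              lpENorm p (convHat (phiHat φ ((i : ℤ) + 1)) u)))) := by ring
      _ = _ := by rw [h2, one_mul]; rfl
  have hm : ∀ s : ℕ → ℝ≥0∞, AEStronglyMeasurable s Measure.count := fun s =>
    (measurable_of_countable s).aestronglyMeasurable
  have h3 := eLpNorm_le_nnreal_smul_eLpNorm_of_ae_le_mul' (μ := (Measure.count : Measure ℕ))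
    (f := besovTerm φ α p f) (c := C.toNNReal)
    (g := ∑ k, besovTerm φ (α - 1) p (spaceDeriv k f) + besovTerm φ (α - 1) p u)
    (Eventually.of_forall fun i => by simpa using h1 i) p
  refine h3.trans ?_
  rw [ENNReal.smul_def, smul_eq_mul]
  gcongr
  refine (eLpNorm_add_le (hm _) (hm _) hp.out).trans ?_
  gcongr
  · exact eLpNorm_sum_le (fun k _ => hm _) hp.out
  · rfl

theorem IsGenerator.besovENorm_le_of_halfTimeDeriv (hφ : IsGenerator φ) (p : ℝ≥0∞) [Fact (1 ≤ p)]
    (α : ℝ) :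
    ∃ C : ℝ≥0, ∀ f u : 𝓢'(SpaceTime n, ℂ), IsHalfTimeDeriv f u →
      besovENorm φ α p p f ≤
        C * (besovENorm φ (α - 1) p p f +
          ∑ k : Fin n, besovENorm φ (α - 1) p p (spaceDeriv k f) +
          besovENorm φ (α - 1) p p u) := by
  obtain ⟨R, hR, HR⟩ := hφ.exists_reverse_bernstein p
  refine ⟨1 + R.toNNReal, fun f u hu => ?_⟩
  -- If the norm of `f` is infinite the bound is trivial; otherwise every piece is in `L^p`, as the
  -- reverse Bernstein inequality requires. The low-frequency part is bounded by the norm of `f`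
  -- itself.
  by_cases hf : besovENorm φ (α - 1) p p f = ∞
  · rw [hf, add_assoc, top_add, ENNReal.mul_top (by simp)]
    exact le_top
  have h1 := besovTail_le_of_reverse_bernstein (α := α) (C := R) (f := f) (u := u) (p := p)
    (φ := φ) fun i => HR _ (by positivity) f u hu (lpENorm_phiHat_ne_top hf i)
  set N := besovENorm φ (α - 1) p p f + ∑ k : Fin n, besovENorm φ (α - 1) p p (spaceDeriv k f) +
    besovENorm φ (α - 1) p p u with hN
  have h2 : lpENorm p (convHat (psiHat φ) f) ≤ N :=
    (lpENorm_psiHat_le_besovENorm (α - 1) f).trans (by rw [hN, add_assoc]; exact le_self_add)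
  have h3 : ∑ k, besovTail φ (α - 1) p (spaceDeriv k f) + besovTail φ (α - 1) p u ≤ N := by
    rw [hN, add_assoc]
    refine le_trans ?_ le_add_self
    gcongr with k
    · exact besovTail_le_besovENorm _ _
    · exact besovTail_le_besovENorm _ _
  calc besovENorm φ α p p f ≤ _ := besovENorm_le α f
    _ ≤ N + R.toNNReal * N := add_le_add h2 (h1.trans (by gcongr))
    _ = _ := by push_cast; ring

theorem IsGenerator.halfTimeDeriv_le_besovENorm (hφ : IsGenerator φ) (p : ℝ≥0∞) [Fact (1 ≤ p)]
    (α : ℝ) :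
    ∃ C : ℝ≥0, ∀ f u : 𝓢'(SpaceTime n, ℂ), IsHalfTimeDeriv f u →
      besovENorm φ (α - 1) p p f +
          ∑ k : Fin n, besovENorm φ (α - 1) p p (spaceDeriv k f) +
          besovENorm φ (α - 1) p p u ≤ C * besovENorm φ α p p f := by
  obtain ⟨χ, hχ⟩ := hφ.exists_schwartz_fatPhi
  obtain ⟨B, -, HB⟩ := exists_bernstein p χ
  obtain ⟨B', -, HB'⟩ := exists_bernstein p (psiSchwartz hφ)
  set K : ℝ≥0 := ((2⁻¹ : ℝ)⁻¹ * B').toNNReal + B.toNNReal with hK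
  refine ⟨2 + n * K + K, fun f u hu => ?_⟩
  by_cases hf : besovENorm φ α p p f = ∞
  · rw [hf, ENNReal.mul_top (by simp)]
    exact le_top
  have hψ : lpENorm p (convHat (psiHat φ) f) ≠ ∞ :=
    ((lpENorm_psiHat_le_besovENorm α f).trans_lt (lt_top_iff_ne_top.2 hf)).ne
  -- The low-frequency piece is localized by `psiHat` dilated by `1/2`, which is `fatPsi` by
  -- definition.
  have hlow := HB' 2⁻¹ (psiHat φ) (by norm_num) (by norm_num) hφ.hasTemperateGrowth_psiHat
    hφ.fatPsi_mul_psiHat f hψ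
  have hhigh := fun i : ℕ => HB ((2 : ℝ) ^ (-((i : ℤ) + 1))) (phiHat φ ((i : ℤ) + 1))
    (by positivity) (zpow_le_one_of_nonpos₀ one_le_two (by omega)) (hasTemperateGrowth_phiHat φ _)
    (by
      rw [← hφ.fatPhi_mul_phiHat]
      congr 1
      · ext z; rw [hχ, fatPhi_dilate]
      · exact hφ.fatPhi_mul_phiHat _) f (lpENorm_phiHat_ne_top hf i)
  have main : ∀ g : 𝓢'(SpaceTime n, ℂ),
      lpENorm p (convHat (psiHat φ) g) ≤ ENNReal.ofReal ((2⁻¹ : ℝ)⁻¹ * B') *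
        lpENorm p (convHat (psiHat φ) f) →
      besovTail φ (α - 1) p g ≤ B.toNNReal * besovTail φ α p f →
      besovENorm φ (α - 1) p p g ≤ K * besovENorm φ α p p f := by
    intro g h1 h2
    calc _ ≤ _ := besovENorm_le (α - 1) g
      _ ≤ (((2⁻¹ : ℝ)⁻¹ * B').toNNReal : ℝ≥0∞) * besovENorm φ α p p f +
          B.toNNReal * besovENorm φ α p p f := by
          refine add_le_add (h1.trans ?_) (h2.trans ?_)
          · gcongr
            · rfl
            · exact lpENorm_psiHat_le_besovENorm α f
          · gcongr
            exact besovTail_le_besovENorm α f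
      _ = _ := by rw [hK]; push_cast; ring
  have m1 : besovENorm φ (α - 1) p p f ≤ 2 * besovENorm φ α p p f := by
    have h1 : besovTail φ (α - 1) p f ≤ (1 : ℝ≥0) * besovTail φ α p f :=
      besovTail_le_mul fun i => by simpa using besovTerm_sub_one_le α f i
    calc _ ≤ _ := besovENorm_le (α - 1) f
      _ ≤ besovENorm φ α p p f + besovENorm φ α p p f :=
          add_le_add (lpENorm_psiHat_le_besovENorm α f)
            (h1.trans (by simpa using besovTail_le_besovENorm α f))
      _ = _ := (two_mul _).symm
  have m2 : ∀ k, besovENorm φ (α - 1) p p (spaceDeriv k f) ≤ K * besovENorm φ α p p f := fun k =>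
    main _ (hlow.1 k)
      (besovTail_le_mul fun i => besovTerm_sub_one_le_of_bernstein ((hhigh i).1 k))
  have m3 : besovENorm φ (α - 1) p p u ≤ K * besovENorm φ α p p f :=
    main _ (hlow.2 u hu)
      (besovTail_le_mul fun i => besovTerm_sub_one_le_of_bernstein ((hhigh i).2 u hu))
  calc _ ≤ 2 * besovENorm φ α p p f + ∑ _k : Fin n, K * besovENorm φ α p p f +
        K * besovENorm φ α p p f := add_le_add (add_le_add m1 (Finset.sum_le_sum fun k _ => m2 k)) m3
    _ = _ := by simp; ring

theorem besovENorm_sub_one_lt_top {α : ℝ} {f : 𝓢'(SpaceTime n, ℂ)}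
    (hf : besovENorm φ α p p f < ∞) : besovENorm φ (α - 1) p p f < ∞ := by
  have h1 : besovTail φ (α - 1) p f ≤ (1 : ℝ≥0) * besovTail φ α p f :=
    besovTail_le_mul fun i => by simpa using besovTerm_sub_one_le α f i
  refine (besovENorm_le (α - 1) f).trans_lt (ENNReal.add_lt_top.2
    ⟨(lpENorm_psiHat_le_besovENorm α f).trans_lt hf, ?_⟩)
  exact (h1.trans (by simpa using besovTail_le_besovENorm α f)).trans_lt hf

end BesovNorm

/-! ### Existence and uniqueness of the half derivative on Besov spaces. -/

section Existence

variable {n : ℕ} {φ : 𝓢(SpaceTime n, ℂ)} {p : ℝ≥0∞} [hp : Fact (1 ≤ p)]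

/-- A distribution in a Besov space is the sum of an `L^p` function and a polynomial differential
operator applied to an `L^p` function. -/
theorem IsGenerator.exists_eq_add_convHat_parabolicPoly (hφ : IsGenerator φ) {β : ℝ}
    {f : 𝓢'(SpaceTime n, ℂ)} (hf : besovENorm φ β p p f < ∞) :
    ∃ (N : ℕ) (g₀ g₁ : Lp ℂ p (volume : Measure (SpaceTime n))),
      f = (g₀ : 𝓢'(SpaceTime n, ℂ)) +
        convHat (fun z => (parabolicPoly z : ℂ) ^ N) (g₁ : 𝓢'(SpaceTime n, ℂ)) := by
  -- Dividing by `P^N` gains `2^{-4N(i+1)}`, and `4N + β ≥ 1` suffices for a geometric series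
  -- against the growth `2^{-β(i+1)}` of the pieces.
  obtain ⟨N, hN⟩ := exists_nat_ge (1 - β)
  obtain ⟨W, hW⟩ := hφ.exists_schwartz_parabolicPoly_mul N
  obtain ⟨D, hD, HD⟩ := exists_isLpMultiplier_dilate p W
  have hP : (fun z : SpaceTime n => (parabolicPoly z : ℂ) ^ N).HasTemperateGrowth :=
    (hasTemperateGrowth_ofReal_comp hasTemperateGrowth_parabolicPoly).pow N
  obtain ⟨g₀, hg₀⟩ := exists_Lp_of_lpENorm_ne_top
    ((lpENorm_psiHat_le_besovENorm β f).trans_lt hf).ne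
  choose g hg using fun i : ℕ => exists_Lp_of_lpENorm_ne_top (lpENorm_phiHat_ne_top hf.ne i)
  set M := (besovENorm φ β p p f).toReal
  have hgM : ∀ i : ℕ, (2 : ℝ) ^ (β * ((i : ℝ) + 1)) * ‖g i‖ ≤ M := by
    intro i
    have h1 := besovTerm_le_besovENorm (φ := φ) (p := p) β f i
    rw [besovTerm, ← hg, lpENorm_coe] at h1
    have h2 := ENNReal.toReal_mono hf.ne h1
    rw [ENNReal.toReal_mul, toReal_enorm, ← ENNReal.toReal_rpow] at h2
    simpa using h2
  choose h hh hb using fun i : ℕ => (HD ((2 : ℝ) ^ (-((i : ℤ) + 1)))).bound (g i)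
  -- `G i` is the piece divided by `P^N`: the power `r^{4N}` compensates the homogeneity of `P^N`
  -- under the dilation by `r`.
  set G : ℕ → Lp ℂ p (volume : Measure (SpaceTime n)) := fun i =>
    ((((2 : ℝ) ^ (-((i : ℤ) + 1))) ^ (4 * N) : ℝ) : ℂ) • h i with hGdef
  have hGn : ∀ i, ‖G i‖ ≤ D * M * (1 / 2) ^ (i + 1) := by
    intro i
    have e1 : ((2 : ℝ) ^ (-((i : ℤ) + 1))) ^ (4 * N) ≤
        2 ^ (β * ((i : ℝ) + 1)) * (1 / 2) ^ (i + 1) := by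
      have e2 : ((2 : ℝ) ^ (-((i : ℤ) + 1))) ^ (4 * N) =
          (2 : ℝ) ^ (-((i : ℝ) + 1) * (4 * N : ℕ)) := by
        rw [Real.rpow_mul_natCast two_pos.le, ← Real.rpow_intCast]
        push_cast
        rfl
      have e3 : (1 / 2 : ℝ) ^ (i + 1) = (2 : ℝ) ^ (-((i : ℝ) + 1)) := by
        rw [Real.rpow_neg two_pos.le, one_div, inv_pow]
        congr 1
        rw [← Nat.cast_succ, Real.rpow_natCast]
      rw [e2, e3, ← Real.rpow_add two_pos]
      refine Real.rpow_le_rpow_of_exponent_le one_le_two ?_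
      push_cast
      have hi : (0 : ℝ) ≤ (i : ℝ) + 1 := by positivity
      have hN0 : (0 : ℝ) ≤ N := Nat.cast_nonneg N
      nlinarith [mul_nonneg hi (show 0 ≤ 4 * (N : ℝ) + β - 1 by linarith)]
    rw [hGdef, norm_smul, Complex.norm_real, Real.norm_of_nonneg (by positivity)]
    calc _ ≤ (2 ^ (β * ((i : ℝ) + 1)) * (1 / 2) ^ (i + 1)) * (D * ‖g i‖) := by
          gcongr
          exact hb i
      _ = D * (2 ^ (β * ((i : ℝ) + 1)) * ‖g i‖) * (1 / 2) ^ (i + 1) := by ring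
      _ ≤ _ := by gcongr; exact hgM i
  have hsum : Summable G := by
    refine Summable.of_norm_bounded ?_ hGn
    exact ((summable_nat_add_iff 1).2 (summable_geometric_of_lt_one (by norm_num)
      (by norm_num : (1 / 2 : ℝ) < 1))).mul_left _
  refine ⟨N, g₀, ∑' i, G i, ?_⟩
  have hpiece : ∀ i, convHat (fun z => (parabolicPoly z : ℂ) ^ N) (G i : 𝓢'(SpaceTime n, ℂ)) =
      convHat (phiHat φ ((i : ℤ) + 1)) f := by
    intro i
    have hX := hasTemperateGrowth_phiHat φ ((i : ℤ) + 1)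
    have hWt := (HD ((2 : ℝ) ^ (-((i : ℤ) + 1)))).temperate
    rw [hGdef, Lp_coe_smul, hh, hg, convHat_smul_right, convHat_convHat hX hWt,
      convHat_convHat (hX.mul hWt) hP, ← convHat_smul ((hX.mul hWt).mul hP)]
    congr 1
    conv_rhs => rw [← hφ.fatPhi_mul_phiHat]
    ext z
    have q := hW (dilate ((2 : ℝ) ^ (-((i : ℤ) + 1))) z)
    rw [fatPhi_dilate, parabolicPoly_dilate] at q
    simp only [Pi.smul_apply, Pi.mul_apply, smul_eq_mul, ← q]
    push_cast
    ring
  have hlim := (((continuous_convHat (fun z : SpaceTime n => (parabolicPoly z : ℂ) ^ N)).comp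
    continuous_Lp_coe).tendsto _).comp hsum.hasSum.tendsto_sum_nat
  have hlim2 := hlim.const_add (g₀ : 𝓢'(SpaceTime n, ℂ))
  refine tendsto_nhds_unique (hφ.tendsto_sum_convHat f) (hlim2.congr fun J => ?_)
  rw [hg₀]
  congr 1
  simp only [Function.comp_apply]
  rw [← Finset.sum_congr rfl fun i _ => hpiece i, ← convHat_sum_right]
  congr 1
  exact map_sum (Lp.toTemperedDistributionCLM ℂ volume p) G _

theorem IsGenerator.exists_isHalfTimeDeriv (hφ : IsGenerator φ) {β : ℝ}
    {f : 𝓢'(SpaceTime n, ℂ)} (hf : besovENorm φ β p p f < ∞) :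
    ∃ u, IsHalfTimeDeriv f u := by
  obtain ⟨N, g₀, g₁, rfl⟩ := hφ.exists_eq_add_convHat_parabolicPoly hf
  obtain ⟨w₀, h₀⟩ := exists_tendsto_convHat_halfSymbol g₀
  obtain ⟨w₁, h₁⟩ := exists_tendsto_convHat_halfSymbol g₁
  have hP : (fun z : SpaceTime n => (parabolicPoly z : ℂ) ^ N).HasTemperateGrowth :=
    (hasTemperateGrowth_ofReal_comp hasTemperateGrowth_parabolicPoly).pow N
  refine ⟨w₀ + convHat (fun z => (parabolicPoly z : ℂ) ^ N) w₁, isHalfTimeDeriv_iff.2 ?_⟩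
  refine (h₀.add (((continuous_convHat _).tendsto w₁).comp h₁)).congr' ?_
  filter_upwards [self_mem_nhdsWithin] with ε hε
  rw [Function.comp_apply, convHat_add_right, convHat_comm hP (hasTemperateGrowth_halfSymbol hε)]

theorem IsHalfTimeDeriv.unique {f u v : 𝓢'(SpaceTime n, ℂ)} (hu : IsHalfTimeDeriv f u)
    (hv : IsHalfTimeDeriv f v) : u = v :=
  tendsto_nhds_unique (isHalfTimeDeriv_iff.1 hu) (isHalfTimeDeriv_iff.1 hv)

end Existence

end ParabolicBesov

end

/-! ### The characterization theorem. -/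

theorem theorem3p3 (n : ℕ) (p : ℝ≥0∞) [Fact (1 ≤ p)] (α : ℝ)
    (φ : 𝓢(ParabolicBesov.SpaceTime n, ℂ)) (hφ : ParabolicBesov.IsGenerator φ) :
    -- the half-order time derivative is well defined on the smaller-order space
    (∀ f ∈ ParabolicBesov.besovSpace φ (α - 1) p p,
      ∃! u : 𝓢'(ParabolicBesov.SpaceTime n, ℂ), ParabolicBesov.IsHalfTimeDeriv f u) ∧
    -- the characterization
    (∀ f : 𝓢'(ParabolicBesov.SpaceTime n, ℂ),
      f ∈ ParabolicBesov.besovSpace φ α p p ↔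
        f ∈ ParabolicBesov.besovSpace φ (α - 1) p p ∧
        (∀ k : Fin n, ParabolicBesov.spaceDeriv k f ∈ ParabolicBesov.besovSpace φ (α - 1) p p) ∧
        ∃ u : 𝓢'(ParabolicBesov.SpaceTime n, ℂ), ParabolicBesov.IsHalfTimeDeriv f u ∧
          u ∈ ParabolicBesov.besovSpace φ (α - 1) p p) ∧
    -- the equivalence of the norms
    ∃ C : ℝ≥0, ∀ f u : 𝓢'(ParabolicBesov.SpaceTime n, ℂ), ParabolicBesov.IsHalfTimeDeriv f u →
      ParabolicBesov.besovENorm φ α p p f ≤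
        C * (ParabolicBesov.besovENorm φ (α - 1) p p f +
          ∑ k : Fin n, ParabolicBesov.besovENorm φ (α - 1) p p (ParabolicBesov.spaceDeriv k f) +
          ParabolicBesov.besovENorm φ (α - 1) p p u) ∧
      ParabolicBesov.besovENorm φ (α - 1) p p f +
          ∑ k : Fin n, ParabolicBesov.besovENorm φ (α - 1) p p (ParabolicBesov.spaceDeriv k f) +
          ParabolicBesov.besovENorm φ (α - 1) p p u ≤
        C * ParabolicBesov.besovENorm φ α p p f := by
  have key : ∀ f : 𝓢'(ParabolicBesov.SpaceTime n, ℂ),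
      f ∈ ParabolicBesov.besovSpace φ (α - 1) p p →
      ∃ u, ParabolicBesov.IsHalfTimeDeriv f u := fun f hf => hφ.exists_isHalfTimeDeriv hf
  obtain ⟨C₁, h₁⟩ := hφ.besovENorm_le_of_halfTimeDeriv p α
  obtain ⟨C₂, h₂⟩ := hφ.halfTimeDeriv_le_besovENorm p α
  refine ⟨fun f hf => ?_, fun f => ⟨fun hf => ?_, ?_⟩, max C₁ C₂, fun f u hu => ⟨?_, ?_⟩⟩
  · obtain ⟨u, hu⟩ := key f hf
    exact ⟨u, hu, fun v hv => hv.unique hu⟩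
  · obtain ⟨u, hu⟩ := key f (ParabolicBesov.besovENorm_sub_one_lt_top hf)
    have h := (h₂ f u hu).trans_lt (ENNReal.mul_lt_top ENNReal.coe_lt_top hf)
    rw [ENNReal.add_lt_top, ENNReal.add_lt_top, ENNReal.sum_lt_top] at h
    exact ⟨h.1.1, fun k => h.1.2 k (Finset.mem_univ k), u, hu, h.2⟩
  · rintro ⟨hf, hd, u, hu, hub⟩
    refine (h₁ f u hu).trans_lt (ENNReal.mul_lt_top ENNReal.coe_lt_top ?_)
    rw [ENNReal.add_lt_top, ENNReal.add_lt_top, ENNReal.sum_lt_top]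
    exact ⟨⟨hf, fun k _ => hd k⟩, hub⟩
  · refine (h₁ f u hu).trans ?_
    gcongr
    exact le_max_left _ _
  · refine (h₂ f u hu).trans ?_
    gcongr
    exact le_max_right _ _
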